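/- Let $G$ be a compact Lie group with normalised Haar measure, and let $\widehat G$ be the set of equivalence classes of continuous irreducible unitary representations of $G$. For each class $[\xi]\in\widehat G$ fix a representative $\xi$ and an orthonormal basis of its representation space, so that $\xi:G\to\mathbb C^{d_\xi\times d_\xi}$ is a unitary-matrix-valued function, $d_\xi$ being its dimension. Let $1\le p_1,p_2<\infty$, $0<r\le 1$ and $\widetilde{p_1}=\min\{2,p_1\}$. Let $A:L^{p_1}(G)\to L^{p_2}(G)$ be a continuous linear operator whose matrix-valued symbol $\sigma_A(x,\xi):=\xi(x)^*(A\xi)(x)$, where $(A\xi)_{ij}=A(\xi_{ij})$, depends only on $\xi$; that is, for every $[\xi]\in\widehat G$ there is a matrix $\sigma_A(\xi)\in\mathbb C^{d_\xi\times d_\xi}$ with $\sigma_A(x,\xi)=\sigma_A(\xi)$ for almost every $x\in G$. For a matrix $M\in\mathbb C^{d\times d}$ and $s>0$ put $$\|M\|_{S_s}=\big(\operatorname{Tr}(|M|^s)\big)^{1/s},\quad |M|=(M^*M)^{1/2},\qquad \|M\|_{op(\ell^\infty,\ell^\infty)}=\max_{1\le i\le d}\sum_{j=1}^d|M_{ij}|,$$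 and let $M^t$ be the transpose of $M$. A bounded linear operator $T:E\to F$ between Banach spaces is called $r$-nuclear if there are sequences $(x_n')$ in $E'$ and $(y_n)$ in $F$ with $Tx=\sum_{n=1}^\infty\langle x,x_n'\rangle y_n$ for all $x\in E$ and $\sum_{n=1}^\infty\|x_n'\|_{E'}^r\|y_n\|_F^r<\infty$. (1) If $p_2\le 2$ and $$\sum_{[\xi]\in\widehat G}d_\xi^{\,1+\left(\frac1{\widetilde{p_1}}-\frac12\right)r}\,\|\sigma_A(\xi)\|_{S_r}^r<\infty,$$ then $A:L^{p_1}(G)\to L^{p_2}(G)$ is $r$-nuclear. (2) If $p_2>2$ and $$\sum_{[\xi]\in\widehat G}d_\xi^{\,1+\left(\frac1{\widetilde{p_1}}-\frac1{p_2}\right)r}\,\big\|\sigma_A(\xi)^t\big\|_{op(\ell^\infty,\ell^\infty)}^{\frac{p_2-2}{p_2}r}\,\|\sigma_A(\xi)\|_{S_{2r/p_2}}^{\frac{2r}{p_2}}<\infty,$$ then $A:L^{p_1}(G)\to L^{p_2}(G)$ is $r$-nuclear. -/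

import Mathlib

open MeasureTheory
open scoped ENNReal Manifold ContDiff Matrix

noncomputable section

namespace CompactLie

/-- A bounded linear operator `T : E → F` between normed spaces is `r`-nuclear if
`T x = ∑ₙ ⟨x, x'ₙ⟩ yₙ` with `x'ₙ ∈ E'`, `yₙ ∈ F` and `∑ₙ ‖x'ₙ‖ ^ r * ‖yₙ‖ ^ r < ∞`. -/
def IsRNuclear (r : ℝ) {E F : Type*} [NormedAddCommGroup E] [NormedSpace ℂ E]
    [NormedAddCommGroup F] [NormedSpace ℂ F] (T : E →L[ℂ] F) : Prop :=
  ∃ (x' : ℕ → E →L[ℂ] ℂ) (y : ℕ → F),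
    (∀ x : E, HasSum (fun n => x' n x • y n) (T x)) ∧
    Summable fun n => ‖x' n‖ ^ r * ‖y n‖ ^ r

/-- The linear representation on `ℂ ^ d` given by a group homomorphism into `U(d)`. -/
def unitaryRepresentation {G : Type*} [Group G] {d : ℕ}
    (ρ : G →* Matrix.unitaryGroup (Fin d) ℂ) : Representation ℂ G (Fin d → ℂ) where
  toFun x := Matrix.toLin' (ρ x : Matrix (Fin d) (Fin d) ℂ)
  map_one' := by simp [Module.End.one_eq_id]
  map_mul' x y := by simp [Matrix.toLin'_mul, Module.End.mul_eq_comp]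

/-- A continuous irreducible unitary representation of `G`, written as a matrix-valued function
by means of an orthonormal basis of the representation space. (For a compact group every
continuous irreducible unitary representation is finite dimensional.) -/
structure IrrepMatrix (G : Type*) [Group G] [TopologicalSpace G] where
  dim : ℕ
  hom : G →* Matrix.unitaryGroup (Fin dim) ℂ
  continuous_hom : Continuous hom
  irreducible : (unitaryRepresentation hom).IsIrreducible

variable {G : Type*} [Group G] [TopologicalSpace G]

/-- The matrix `ξ(x)`. -/
def IrrepMatrix.mat (ξ : IrrepMatrix G) (x : G) : Matrix (Fin ξ.dim) (Fin ξ.dim) ℂ :=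
  (ξ.hom x : Matrix (Fin ξ.dim) (Fin ξ.dim) ℂ)

/-- Unitary equivalence of representations; the intertwiner `U` is a unitary matrix. -/
def IrrepMatrix.Equivalent (ξ η : IrrepMatrix G) : Prop :=
  ∃ U : Matrix (Fin η.dim) (Fin ξ.dim) ℂ,
    Uᴴ * U = 1 ∧ U * Uᴴ = 1 ∧ ∀ x, U * ξ.mat x = η.mat x * U

instance IrrepMatrix.setoid : Setoid (IrrepMatrix G) where
  r := IrrepMatrix.Equivalent
  iseqv :=
    { refl := fun _ => ⟨1, by simp, by simp, by simp⟩
      symm := by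
        rintro ξ η ⟨U, h₁, h₂, h₃⟩
        refine ⟨Uᴴ, by simpa using h₂, by simpa using h₁, fun x => ?_⟩
        calc Uᴴ * η.mat x = Uᴴ * (η.mat x * U) * Uᴴ := by
              simp only [Matrix.mul_assoc, h₂, Matrix.mul_one]
          _ = ξ.mat x * Uᴴ := by
              rw [← h₃ x, ← Matrix.mul_assoc, h₁, Matrix.one_mul]
      trans := by
        rintro ξ η ζ ⟨U, h₁, h₂, h₃⟩ ⟨V, k₁, k₂, k₃⟩
        refine ⟨V * U, ?_, ?_, fun x => ?_⟩
        · calc (V * U)ᴴ * (V * U) = Uᴴ * (Vᴴ * V) * U := by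
                simp only [Matrix.conjTranspose_mul, Matrix.mul_assoc]
            _ = 1 := by rw [k₁, Matrix.mul_one, h₁]
        · calc (V * U) * (V * U)ᴴ = V * (U * Uᴴ) * Vᴴ := by
                simp only [Matrix.conjTranspose_mul, Matrix.mul_assoc]
            _ = 1 := by rw [h₂, Matrix.mul_one, k₂]
        · rw [Matrix.mul_assoc, h₃ x, ← Matrix.mul_assoc, k₃ x, Matrix.mul_assoc] }

/-- The unitary dual `Ĝ`: equivalence classes of continuous irreducible unitary
representations. -/
def UnitaryDual (G : Type*) [Group G] [TopologicalSpace G] : Type _ :=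
  Quotient (IrrepMatrix.setoid (G := G))

/-- The matrix coefficient `x ↦ ξ(x)ᵢⱼ` as a continuous function on `G`. -/
def IrrepMatrix.coeff (ξ : IrrepMatrix G) (i j : Fin ξ.dim) : C(G, ℂ) where
  toFun x := ξ.mat x i j
  continuous_toFun :=
    (continuous_subtype_val.comp ξ.continuous_hom).matrix_elem i j

/-- The matrix-valued symbol `σ_A(x, ξ) = ξ(x)* (Aξ)(x)`, where `A` is applied to each matrix
coefficient of `ξ`. As `A ξᵢⱼ` is an element of `L^{p₂}`, it is meaningful for almost every `x`. -/
def symbol [MeasurableSpace G] [BorelSpace G] [CompactSpace G]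
    {μ : Measure G} [IsFiniteMeasure μ] {p₁ p₂ : ℝ≥0∞} [Fact (1 ≤ p₁)] [Fact (1 ≤ p₂)]
    (A : Lp ℂ p₁ μ →L[ℂ] Lp ℂ p₂ μ) (x : G) (ξ : IrrepMatrix G) :
    Matrix (Fin ξ.dim) (Fin ξ.dim) ℂ :=
  (ξ.mat x)ᴴ *
    Matrix.of fun i j => (A (ContinuousMap.toLp p₁ μ ℂ (ξ.coeff i j)) : G → ℂ) x

/-- The Schatten (quasi-)norm `(Tr |M| ^ r) ^ (1 / r)`, where `|M| = (M* M) ^ (1/2)` and the powers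
are given by the functional calculus of the Hermitian matrix `M* M`. -/
def schattenNorm (r : ℝ) {d : ℕ} (M : Matrix (Fin d) (Fin d) ℂ) : ℝ :=
  (Matrix.trace (cfc (fun t : ℝ => √t ^ r) (Mᴴ * M))).re ^ (1 / r)

/-- The operator norm on `ℓ^∞`: `max_i ∑_j |B i j|`. -/
def opNormLinfty {d : ℕ} (B : Matrix (Fin d) (Fin d) ℂ) : ℝ :=
  ⨆ i, ∑ j, ‖B i j‖

end CompactLie

end

/-! Both parts rest on one estimate, valid for every finite `p₂`: the Schatten condition of (1)
already gives `r`-nuclearity, and the condition of (2) implies that of (1).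

If the symbol at `ξ` is a constant matrix `M`, then `A ξ_ab = ∑_c ξ_ac M_cb`. Let `d` be the
dimension of `ξ`. By Schur orthogonality this block of `A` equals `f ↦ ∑_{k,i} d ⟨f, (W_k ξ V)_ik⟩
(W_k ξ M V)_ik` for all unitary `V` and `W_k`. Let `V` consist of right singular vectors of `M`;
column `k` of `ξ(x) M V` then has `ℓ²` norm equal to the singular value `s_k` for every `x`. A
random rotation `W_k` (Fourier matrix times random signs) spreads that column evenly: by
Khintchine's inequality some choice makes the `L^{2m}` norms of its entries on average of order `s_k
/ √d` (`exists_unitary_sum_integral_pow_le`). The functionals have norm at most `d ^ (-1 + 1 / min 2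
p₁)`, since entries of unitary matrices are bounded by 1 and here have mean square `1 / d`. Summing
`r`-th powers over the `d²` pairs gives the term of condition (1), up to a constant depending only
on `m` and `r` (`exists_rank_one_decomposition`).

As `r ≤ 1`, all the rank-one operators together are absolutely summable in operator norm. Their sum
agrees with `A` on matrix coefficients, which are total in `L^{p₁}` by the Peter–Weyl theorem
(`topologicalClosure_coeffSpan`, proved here by compact convolution operators), so it is `A`
(`isRNuclear_of_family`).

For (2), each singular value is at most `√d` times the maximal column sum of `M`. Applying this to a
fraction `(p₂ - 2) / p₂` of the power `s_k ^ r` turns one condition into the other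
(`schattenNorm_rpow_le`). -/

noncomputable section

set_option linter.unusedSectionVars false

namespace CompactLie

/-! ### Coefficients of finite-dimensional invariant subspaces -/

section Coefficients

variable {G : Type*} [Group G] [TopologicalSpace G]

/-- The linear span of all matrix coefficients of continuous irreducible unitary
representations. -/
def coeffSpan (G : Type*) [Group G] [TopologicalSpace G] : Submodule ℂ C(G, ℂ) :=
  Submodule.span ℂ {f | ∃ (ξ : IrrepMatrix G) (i j : Fin ξ.dim), f = ξ.coeff i j}

variable {H : Type*} [NormedAddCommGroup H] [InnerProductSpace ℂ H]

theorem inner_map_map_of_norm_map (T : H →ₗ[ℂ] H) (hT : ∀ v, ‖T v‖ = ‖v‖) (v w : H) :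
    inner ℂ (T v) (T w) = inner ℂ v w :=
  (⟨T, hT⟩ : H →ₗᵢ[ℂ] H).inner_map_map v w

/-- The unitary matrix of an isometric group action on an invariant subspace with respect to an
orthonormal basis. -/
def matrixHom {V : Submodule ℂ H} {d : ℕ} (b : OrthonormalBasis (Fin d) ℂ V)
    (ρ : Representation ℂ G H) (hρ : ∀ g v, ‖ρ g v‖ = ‖v‖) (hV : ∀ g, ∀ v ∈ V, ρ g v ∈ V) :
    G →* Matrix.unitaryGroup (Fin d) ℂ :=
  MonoidHom.mk' (fun g => ⟨Matrix.of fun i j => inner ℂ (b i) ⟨ρ g (b j), hV g _ (b j).2⟩, by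
    rw [Matrix.mem_unitaryGroup_iff']
    ext i j
    have h := b.sum_inner_mul_inner ⟨ρ g (b i), hV g _ (b i).2⟩ ⟨ρ g (b j), hV g _ (b j).2⟩
    have h2 : inner ℂ (b i) (b j) = (1 : Matrix (Fin d) (Fin d) ℂ) i j := by
      rw [orthonormal_iff_ite.mp b.orthonormal i j, Matrix.one_apply]
    rw [← h2, Matrix.mul_apply]
    simp only [Matrix.star_apply, Matrix.of_apply, RCLike.star_def, inner_conj_symm]
    rw [h, Submodule.coe_inner, Submodule.coe_inner]
    exact inner_map_map_of_norm_map (ρ g) (hρ g) _ _⟩) (by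
  intro g h
  ext i j
  change inner ℂ (b i) (⟨ρ (g * h) (b j), _⟩ : V) =
    (Matrix.of (fun i j => inner ℂ (b i) (⟨ρ g (b j), hV g _ (b j).2⟩ : V)) *
      Matrix.of (fun i j => inner ℂ (b i) (⟨ρ h (b j), hV h _ (b j).2⟩ : V))) i j
  rw [Matrix.mul_apply]
  have key : (⟨ρ (g * h) (b j), hV _ _ (b j).2⟩ : V) =
      ∑ k, (inner ℂ (b k) (⟨ρ h (b j), hV h _ (b j).2⟩ : V)) •
        (⟨ρ g (b k), hV g _ (b k).2⟩ : V) := by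
    apply Subtype.ext
    have h1 := congrArg (fun v : V => ρ g v) (b.sum_repr' (⟨ρ h (b j), hV h _ (b j).2⟩ : V))
    simp only [Submodule.coe_sum, Submodule.coe_smul, map_sum, map_smul] at h1 ⊢
    rw [h1, map_mul]
    rfl
  rw [key, inner_sum]
  refine Finset.sum_congr rfl fun k _ => ?_
  rw [inner_smul_right, mul_comm]
  rfl)

theorem apply_basis_eq_sum {V : Submodule ℂ H} {d : ℕ} (b : OrthonormalBasis (Fin d) ℂ V)
    (ρ : Representation ℂ G H) (hρ : ∀ g v, ‖ρ g v‖ = ‖v‖) (hV : ∀ g, ∀ v ∈ V, ρ g v ∈ V)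
    (g : G) (j : Fin d) :
    ρ g (b j) = ∑ i, (matrixHom b ρ hρ hV g : Matrix (Fin d) (Fin d) ℂ) i j • (b i : H) := by
  have h1 := congrArg (fun v : V => (v : H)) (b.sum_repr' (⟨ρ g (b j), hV g _ (b j).2⟩ : V))
  simp only [Submodule.coe_sum, Submodule.coe_smul] at h1
  exact h1.symm

/-- The coordinate map `E` of the basis intertwines the matrix representation with `ρ`, so a
subrepresentation is carried to an invariant subspace of `V`, to which minimality applies. -/
theorem isIrreducible_matrixHom {V : Submodule ℂ H} (hV0 : V ≠ ⊥) {d : ℕ}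
    (b : OrthonormalBasis (Fin d) ℂ V)
    (ρ : Representation ℂ G H) (hρ : ∀ g v, ‖ρ g v‖ = ‖v‖) (hV : ∀ g, ∀ v ∈ V, ρ g v ∈ V)
    (hmin : ∀ W : Submodule ℂ H, W ≤ V → (∀ g, ∀ v ∈ W, ρ g v ∈ W) → W = ⊥ ∨ W = V) :
    (unitaryRepresentation (matrixHom b ρ hρ hV)).IsIrreducible := by
  let e : (Fin d → ℂ) ≃ₗ[ℂ] V := b.toBasis.equivFun.symm
  let E : (Fin d → ℂ) →ₗ[ℂ] H := V.subtype ∘ₗ e.toLinearMap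
  have hE : ∀ c, E c = ∑ j, c j • (b j : H) := fun c => by
    have h : E c = ((b.toBasis.equivFun.symm c : V) : H) := rfl
    rw [h, Module.Basis.equivFun_symm_apply]
    simp
  have hEinj : Function.Injective E := V.injective_subtype.comp e.injective
  have hEV : ∀ c, E c ∈ V := fun c => (e c).2
  have hEg : ∀ g c, E (unitaryRepresentation (matrixHom b ρ hρ hV) g c) = ρ g (E c) := by
    intro g c
    rw [hE, hE, map_sum]
    simp only [map_smul, apply_basis_eq_sum b ρ hρ hV g, Finset.smul_sum, smul_smul]
    rw [Finset.sum_comm]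
    refine Finset.sum_congr rfl fun i _ => ?_
    rw [← Finset.sum_smul]
    congr 1
    simp only [unitaryRepresentation, MonoidHom.coe_mk, OneHom.coe_mk, Matrix.toLin'_apply,
      Matrix.mulVec, dotProduct]
    exact Finset.sum_congr rfl fun j _ => mul_comm _ _
  have hne : Nontrivial (Subrepresentation (unitaryRepresentation (matrixHom b ρ hρ hV))) := by
    refine ⟨⟨⊥, ⊤, fun h => hV0 ?_⟩⟩
    have h' : (⊥ : Submodule ℂ (Fin d → ℂ)) = ⊤ := congrArg Subrepresentation.toSubmodule h
    rw [Submodule.eq_bot_iff]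
    intro v hv
    have : e.symm ⟨v, hv⟩ ∈ (⊥ : Submodule ℂ (Fin d → ℂ)) := h' ▸ Submodule.mem_top
    rw [Submodule.mem_bot, LinearEquiv.map_eq_zero_iff] at this
    exact congrArg Subtype.val this
  refine @IsSimpleOrder.mk _ _ _ hne fun W => ?_
  have hle : W.toSubmodule.map E ≤ V := by
    rintro _ ⟨c, _, rfl⟩
    exact hEV c
  have hinv : ∀ g, ∀ v ∈ W.toSubmodule.map E, ρ g v ∈ W.toSubmodule.map E := by
    rintro g _ ⟨c, hc, rfl⟩
    exact ⟨_, W.apply_mem_toSubmodule g hc, hEg g c⟩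
  rcases hmin _ hle hinv with h | h
  · left
    apply Subrepresentation.toSubmodule_injective
    change W.toSubmodule = ⊥
    rw [Submodule.eq_bot_iff]
    intro c hc
    have h1 : E c ∈ (⊥ : Submodule ℂ H) := h ▸ Submodule.mem_map_of_mem hc
    rw [Submodule.mem_bot, ← map_zero E] at h1
    exact hEinj h1
  · right
    apply Subrepresentation.toSubmodule_injective
    change W.toSubmodule = ⊤
    rw [Submodule.eq_top_iff']
    intro c
    have : E c ∈ W.toSubmodule.map E := by rw [h]; exact hEV c
    obtain ⟨c', hc', hcc⟩ := this
    rwa [← hEinj hcc]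

/-- The coefficients of a strongly continuous isometric representation on a finite-dimensional
invariant subspace are linear combinations of coefficients of irreducible representations. -/
theorem exists_mem_coeffSpan_of_finiteDimensional (ρ : Representation ℂ G H)
    (hρ : ∀ g v, ‖ρ g v‖ = ‖v‖) (hc : ∀ v, Continuous fun g => ρ g v) (V : Submodule ℂ H)
    [FiniteDimensional ℂ V] (hV : ∀ g, ∀ v ∈ V, ρ g v ∈ V) (v : H) (hv : v ∈ V) (w : H) :
    ∃ f ∈ coeffSpan G, ∀ x, f x = inner ℂ w (ρ x v) := by
  induction hn : Module.finrank ℂ V using Nat.strong_induction_on generalizing V v with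
  | _ n ih =>
  by_cases hmin : ∀ W : Submodule ℂ H, W ≤ V → (∀ g, ∀ v ∈ W, ρ g v ∈ W) → W = ⊥ ∨ W = V
  · by_cases hV0 : V = ⊥
    · subst hV0
      rw [Submodule.mem_bot] at hv
      exact ⟨0, zero_mem _, by simp [hv]⟩
    · let b := stdOrthonormalBasis ℂ V
      let ξ : IrrepMatrix G :=
        { dim := Module.finrank ℂ V
          hom := matrixHom b ρ hρ hV
          continuous_hom := by
            refine Continuous.subtype_mk (continuous_matrix fun i j => ?_) _
            exact continuous_const.inner (hc (b j))
          irreducible := isIrreducible_matrixHom hV0 b ρ hρ hV hmin }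
      refine ⟨∑ j, ∑ i, (inner ℂ (b j) (⟨v, hv⟩ : V) * inner ℂ w (b i : H)) • ξ.coeff i j,
        Submodule.sum_mem _ fun j _ => Submodule.sum_mem _ fun i _ => Submodule.smul_mem _ _
          (Submodule.subset_span ⟨ξ, i, j, rfl⟩), fun x => ?_⟩
      have h1 : v = ∑ j, inner ℂ (b j) (⟨v, hv⟩ : V) • (b j : H) := by
        have := congrArg (fun v : V => (v : H)) (b.sum_repr' (⟨v, hv⟩ : V))
        simpa only [Submodule.coe_sum, Submodule.coe_smul] using this.symm
      have h2 : ρ x v = ∑ j, inner ℂ (b j) (⟨v, hv⟩ : V) • ρ x (b j : H) := by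
        conv_lhs => rw [h1]
        simp only [map_sum, map_smul]
      rw [h2, inner_sum, ContinuousMap.sum_apply]
      refine Finset.sum_congr rfl fun j _ => ?_
      rw [inner_smul_right, apply_basis_eq_sum b ρ hρ hV x j, inner_sum, Finset.mul_sum,
        ContinuousMap.sum_apply]
      refine Finset.sum_congr rfl fun i _ => ?_
      rw [inner_smul_right, ContinuousMap.smul_apply, smul_eq_mul]
      change _ * (matrixHom b ρ hρ hV x : Matrix _ _ ℂ) i j = _
      ring
  -- `V` splits as `W ⊕ (Wᗮ ⊓ V)`; the complement is invariant because the action is isometric, and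
  -- both summands have smaller dimension.
  · push Not at hmin
    obtain ⟨W, hWV, hWi, hW0, hWne⟩ := hmin
    have hWfin : FiniteDimensional ℂ W := Submodule.finiteDimensional_of_le hWV
    have hlt : Module.finrank ℂ W < n := hn ▸ Submodule.finrank_lt_finrank_of_lt
      (lt_of_le_of_ne hWV hWne)
    have hUV : Wᗮ ⊓ V ≤ V := inf_le_right
    have hUfin : FiniteDimensional ℂ (Wᗮ ⊓ V : Submodule ℂ H) :=
      Submodule.finiteDimensional_of_le hUV
    have hUi : ∀ g, ∀ v ∈ Wᗮ ⊓ V, ρ g v ∈ Wᗮ ⊓ V := by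
      rintro g v ⟨hv1, hv2⟩
      refine ⟨?_, hV g v hv2⟩
      rw [SetLike.mem_coe, Submodule.mem_orthogonal] at hv1 ⊢
      intro u hu
      have h1 : u = ρ g (ρ g⁻¹ u) := by
        rw [← Module.End.mul_apply, ← map_mul]; simp
      rw [h1, inner_map_map_of_norm_map (ρ g) (hρ g)]
      exact hv1 _ (hWi _ _ hu)
    have hUlt : Module.finrank ℂ (Wᗮ ⊓ V : Submodule ℂ H) < n := by
      have h1 := Submodule.finrank_add_inf_finrank_orthogonal hWV
      have h2 : 0 < Module.finrank ℂ W := by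
        rw [Module.finrank_pos_iff]
        exact (Submodule.nontrivial_iff_ne_bot).mpr hW0
      omega
    have hvdec : v ∈ W ⊔ (Wᗮ ⊓ V) := by
      rw [Submodule.sup_orthogonal_inf_of_hasOrthogonalProjection hWV]; exact hv
    obtain ⟨v₁, hv₁, v₂, hv₂, rfl⟩ := Submodule.mem_sup.mp hvdec
    obtain ⟨f₁, hf₁, h₁⟩ := ih _ hlt W hWi v₁ hv₁ rfl
    obtain ⟨f₂, hf₂, h₂⟩ := ih _ hUlt (Wᗮ ⊓ V) hUi v₂ hv₂ rfl
    exact ⟨f₁ + f₂, add_mem hf₁ hf₂, fun x => by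
      rw [ContinuousMap.add_apply, h₁, h₂, map_add, inner_add_right]⟩

end Coefficients

/-! ### The Peter–Weyl theorem via compact convolution operators -/

section PeterWeyl

variable {G : Type*} [Group G] [TopologicalSpace G] [IsTopologicalGroup G] [T2Space G]
  [CompactSpace G]

/-- A bump function near 1, symmetrised under inversion and normalised to integral 1. The symmetry
is what makes the convolution operator self-adjoint later. -/
theorem exists_approximate_identity [MeasurableSpace G] [BorelSpace G] (μ : Measure G)
    [μ.IsHaarMeasure] [IsProbabilityMeasure μ] (φ : C(G, ℂ)) {ε : ℝ} (hε : 0 < ε) :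
    ∃ w : C(G, ℂ), (∀ g, w g⁻¹ = starRingEnd ℂ (w g)) ∧
      ∀ x, ‖(∫ y, starRingEnd ℂ (w y) * φ (x * y) ∂μ) - φ x‖ ≤ ε := by
  -- Currying makes the right translates of `φ` depend continuously on the translation in sup norm,
  -- so closeness to `φ` is uniform in `x`.
  let F : C(G, C(G, ℂ)) := ContinuousMap.curry ⟨fun p : G × G => φ (p.2 * p.1), by fun_prop⟩
  have hF : F ⁻¹' Metric.ball φ ε ∈ nhds (1 : G) := by
    apply F.continuous.continuousAt
    apply Metric.isOpen_ball.mem_nhds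
    have : F 1 = φ := by ext x; simp [F]
    rw [this]
    exact Metric.mem_ball_self hε
  let U : Set G := interior (F ⁻¹' Metric.ball φ ε)
  let S : Set G := U ∩ U⁻¹
  have hS1 : (1 : G) ∈ S := by
    have : (1 : G) ∈ U := mem_interior_iff_mem_nhds.mpr hF
    exact ⟨this, by simpa using this⟩
  have hSo : IsOpen S := isOpen_interior.inter isOpen_interior.inv
  obtain ⟨u, hu0, hu1, hu⟩ := exists_continuous_zero_one_of_isClosed (X := G) hSo.isClosed_compl
    (isClosed_singleton (x := (1 : G))) (by simpa using hS1)
  let v : C(G, ℝ) := ⟨fun x => u x + u x⁻¹, by fun_prop⟩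
  have hv0 : ∀ x, 0 ≤ v x := fun x => add_nonneg (hu x).1 (hu x⁻¹).1
  have hvi : ∀ x, v x⁻¹ = v x := fun x => by simp [v, add_comm]
  have hvS : ∀ x, x ∉ S → v x = 0 := by
    intro x hx
    have hx' : x⁻¹ ∉ S := fun h => hx ⟨by simpa using h.2, by simpa using h.1⟩
    have h1 := hu0 hx
    have h2 := hu0 hx'
    simp only [Pi.zero_apply] at h1 h2
    simp [v, h1, h2]
  have hvint : Integrable v μ := v.continuous.integrable_of_hasCompactSupport
    (HasCompactSupport.of_compactSpace _)
  have hI : 0 < ∫ x, v x ∂μ := by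
    refine v.continuous.integral_pos_of_hasCompactSupport_nonneg_nonzero
      (HasCompactSupport.of_compactSpace _) hv0 (x := 1) ?_
    have h1 : u 1 = 1 := hu1 (Set.mem_singleton _)
    simp [v, h1]
  set I := ∫ x, v x ∂μ with hIdef
  refine ⟨⟨fun x => ((v x / I : ℝ) : ℂ), by fun_prop⟩, fun g => ?_, fun x => ?_⟩
  · simp [hvi]
  · have hone : ∫ y, ((v y / I : ℝ) : ℂ) ∂μ = 1 := by
      rw [integral_complex_ofReal, integral_div, div_self hI.ne']
      simp
    have hx : φ x = ∫ y, ((v y / I : ℝ) : ℂ) * φ x ∂μ := by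
      rw [integral_mul_const, hone, one_mul]
    have hcont : ∀ f : G → ℂ, Continuous f → Integrable f μ := fun f hf =>
      hf.integrable_of_hasCompactSupport (HasCompactSupport.of_compactSpace _)
    rw [hx, ← integral_sub (hcont _ (by fun_prop)) (hcont _ (by fun_prop))]
    refine (norm_integral_le_integral_norm _).trans ?_
    have hle : ∫ y, v y / I * ε ∂μ = ε := by
      rw [integral_mul_const, integral_div, div_self hI.ne', one_mul]
    rw [← hle]
    refine integral_mono_of_nonneg (Filter.Eventually.of_forall fun _ => norm_nonneg _)
      ((hvint.div_const I).mul_const ε) (Filter.Eventually.of_forall fun y => ?_)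
    simp only [ContinuousMap.coe_mk, Complex.conj_ofReal]
    rw [← mul_sub, norm_mul, Complex.norm_real, Real.norm_of_nonneg (div_nonneg (hv0 y) hI.le)]
    by_cases hy : y ∈ S
    · refine mul_le_mul_of_nonneg_left ?_ (div_nonneg (hv0 y) hI.le)
      have h1 : F y ∈ Metric.ball φ ε := interior_subset (s := F ⁻¹' Metric.ball φ ε) hy.1
      have h2 : dist (F y x) (φ x) ≤ dist (F y) φ := ContinuousMap.dist_apply_le_dist x
      rw [dist_eq_norm] at h2
      exact h2.trans (Metric.mem_ball.mp h1).le
    · simp [hvS y hy]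

instance fact_two_ne_top : Fact ((2 : ℝ≥0∞) ≠ ⊤) := ⟨ENNReal.ofNat_ne_top⟩

variable [SecondCountableTopology G] [MeasurableSpace G] [BorelSpace G] (μ : Measure G)
  [μ.IsHaarMeasure] [IsProbabilityMeasure μ]

/-- The left regular representation on `L²`. -/
def leftRegular : Representation ℂ G (Lp ℂ 2 μ) where
  toFun x :=
    { toFun := fun h => DomMulAct.mk x⁻¹ • h
      map_add' := fun f g => smul_add _ f g
      map_smul' := fun c f => smul_comm _ c f }
  map_one' := by ext1 h; simp
  map_mul' x y := by
    ext1 h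
    simp [mul_smul]

theorem norm_leftRegular (x : G) (h : Lp ℂ 2 μ) : ‖leftRegular μ x h‖ = ‖h‖ :=
  DomMulAct.norm_smul_Lp _ _

theorem continuous_leftRegular (h : Lp ℂ 2 μ) : Continuous fun x => leftRegular μ x h := by
  have h1 : Continuous fun x : G => DomMulAct.mk x⁻¹ :=
    DomMulAct.continuous_mk.comp continuous_inv
  exact h1.smul continuous_const

theorem leftRegular_toLp (x : G) (f : C(G, ℂ)) :
    leftRegular μ x (ContinuousMap.toLp 2 μ ℂ f) =
      ContinuousMap.toLp 2 μ ℂ (f.comp ⟨fun y => x⁻¹ * y, by fun_prop⟩) :=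
  rfl

/-- Convolution with a fixed square integrable function, as an operator from `L²` to the
continuous functions. -/
def convolution (w : Lp ℂ 2 μ) : Lp ℂ 2 μ →L[ℂ] C(G, ℂ) :=
  LinearMap.mkContinuous
    { toFun := fun h : Lp ℂ 2 μ => (⟨fun x => inner ℂ (leftRegular μ x w) h,
        (continuous_leftRegular μ w).inner continuous_const⟩ : C(G, ℂ))
      map_add' := fun f g => by ext x; exact inner_add_right (𝕜 := ℂ) (leftRegular μ x w) f g
      map_smul' := fun c f => by ext x; exact inner_smul_right (𝕜 := ℂ) (leftRegular μ x w) f c } ‖w‖ (fun h => by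
    rw [ContinuousMap.norm_le _ (by positivity)]
    intro x
    refine (norm_inner_le_norm (𝕜 := ℂ) (leftRegular μ x w) h).trans ?_
    rw [norm_leftRegular])

theorem convolution_apply (w h : Lp ℂ 2 μ) (x : G) :
    convolution μ w h x = inner ℂ (leftRegular μ x w) h := rfl

theorem convolution_toLp (w h : C(G, ℂ)) (x : G) :
    convolution μ (ContinuousMap.toLp 2 μ ℂ w) (ContinuousMap.toLp 2 μ ℂ h) x =
      ∫ y, h y * starRingEnd ℂ (w (x⁻¹ * y)) ∂μ := by
  rw [convolution_apply, leftRegular_toLp, ContinuousMap.inner_toLp]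
  rfl

theorem convolution_leftRegular (w h : Lp ℂ 2 μ) (z : G) :
    convolution μ w (leftRegular μ z h) =
      (convolution μ w h).comp ⟨fun y => z⁻¹ * y, by fun_prop⟩ := by
  ext x
  have h1 : leftRegular μ x w = leftRegular μ z (leftRegular μ (z⁻¹ * x) w) := by
    rw [← Module.End.mul_apply, ← map_mul, mul_inv_cancel_left]
  rw [convolution_apply, h1, inner_map_map_of_norm_map _ (norm_leftRegular μ z)]
  rfl

/-- Convolution as an operator on `L²`. -/
def convolutionL2 (w : Lp ℂ 2 μ) : Lp ℂ 2 μ →L[ℂ] Lp ℂ 2 μ :=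
  (ContinuousMap.toLp 2 μ ℂ).comp (convolution μ w)

/-- Arzelà–Ascoli: by Cauchy–Schwarz the images of the unit ball are bounded by `‖w‖`, and strong
continuity of `x ↦ leftRegular μ x w` makes them equicontinuous. -/
theorem isCompactOperator_convolutionL2 (w : Lp ℂ 2 μ) :
    IsCompactOperator (convolutionL2 μ w) := by
  let e := ContinuousMap.linearIsometryBoundedOfCompact G ℂ ℂ
  let A : Set (BoundedContinuousFunction G ℂ) :=
    (fun h => e (convolution μ w h)) '' Metric.closedBall 0 1
  have hA : IsCompact (closure A) := by
    refine BoundedContinuousFunction.arzela_ascoli (Metric.closedBall 0 ‖w‖)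
      (isCompact_closedBall _ _) A ?_ ?_
    · rintro _ x ⟨h, hh, rfl⟩
      rw [mem_closedBall_zero_iff] at hh ⊢
      change ‖inner ℂ (leftRegular μ x w) h‖ ≤ _
      refine (norm_inner_le_norm _ _).trans ?_
      rw [norm_leftRegular]
      exact mul_le_of_le_one_right (norm_nonneg _) hh
    · intro x₀
      rw [Metric.equicontinuousAt_iff_right]
      intro ε hε
      have h1 := (continuous_leftRegular μ w).tendsto x₀
      rw [Metric.tendsto_nhds] at h1
      filter_upwards [h1 ε hε] with x hx
      rintro ⟨_, h, hh, rfl⟩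
      rw [mem_closedBall_zero_iff] at hh
      change dist (inner ℂ (leftRegular μ x₀ w) h) (inner ℂ (leftRegular μ x w) h) < ε
      rw [dist_eq_norm, ← inner_sub_left]
      refine (norm_inner_le_norm _ _).trans_lt ?_
      refine (mul_le_of_le_one_right (norm_nonneg _) hh).trans_lt ?_
      rwa [← dist_eq_norm, dist_comm]
  refine ⟨(fun f => ContinuousMap.toLp 2 μ ℂ (e.symm f)) '' closure A,
    hA.image (by fun_prop), ?_⟩
  refine Filter.mem_of_superset (Metric.closedBall_mem_nhds 0 one_pos) fun h hh => ?_
  exact ⟨_, subset_closure ⟨h, hh, rfl⟩, by simp [e, convolutionL2]⟩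

/-- By density it is enough to take continuous functions, where Fubini and the Hermitian symmetry of
the kernel `w (x⁻¹ * y)` apply. -/
theorem isSymmetric_convolutionL2 (w : C(G, ℂ)) (hw : ∀ g, w g⁻¹ = starRingEnd ℂ (w g)) :
    (convolutionL2 μ (ContinuousMap.toLp 2 μ ℂ w) : Lp ℂ 2 μ →ₗ[ℂ] Lp ℂ 2 μ).IsSymmetric := by
  intro f g
  refine DenseRange.induction_on₂ (e := ContinuousMap.toLp (E := ℂ) 2 μ ℂ)
    (p := fun f g => inner ℂ (convolutionL2 μ (ContinuousMap.toLp 2 μ ℂ w) f) g =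
      inner ℂ f (convolutionL2 μ (ContinuousMap.toLp 2 μ ℂ w) g))
    (ContinuousMap.toLp_denseRange ℂ μ ℂ ENNReal.ofNat_ne_top)
    (isClosed_eq (by fun_prop) (by fun_prop)) (fun f g => ?_) f g
  rw [convolutionL2, ContinuousLinearMap.comp_apply, ContinuousLinearMap.comp_apply,
    ContinuousMap.inner_toLp, ContinuousMap.inner_toLp]
  simp only [convolution_toLp, ← integral_conj, ← integral_const_mul, ← integral_mul_const]
  rw [integral_integral_swap]
  · refine integral_congr_ae (Filter.Eventually.of_forall fun x =>
      integral_congr_ae (Filter.Eventually.of_forall fun y => ?_))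
    have h1 : w (y⁻¹ * x) = starRingEnd ℂ (w (x⁻¹ * y)) := by
      rw [← hw]; simp
    simp only [map_mul, h1, Complex.conj_conj]
    ring
  · refine Continuous.integrable_of_hasCompactSupport ?_ (HasCompactSupport.of_compactSpace _)
    simp only [Function.uncurry_def]
    fun_prop

/-- Eigenspaces for `c ≠ 0` are finite dimensional and invariant under left translation. Inversion
appears because `⟨λ(x⁻¹) w, h⟩ = ⟨w, λ(x) h⟩`, a genuine coefficient of the left regular
representation `λ`. -/
theorem convolution_mem_coeffSpan_comp_inv (w : Lp ℂ 2 μ) (c : ℂ) (hc : c ≠ 0) (h : Lp ℂ 2 μ)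
    (hh : h ∈ Module.End.eigenspace (convolutionL2 μ w : Lp ℂ 2 μ →ₗ[ℂ] Lp ℂ 2 μ) c) :
    (convolution μ w h).comp ⟨fun x => x⁻¹, continuous_inv⟩ ∈ coeffSpan G := by
  have hfin := ContinuousLinearMap.finite_dimensional_eigenspace
    (isCompactOperator_convolutionL2 μ w) c hc
  have hinv : ∀ z, ∀ v ∈ Module.End.eigenspace (convolutionL2 μ w : Lp ℂ 2 μ →ₗ[ℂ] Lp ℂ 2 μ) c,
      leftRegular μ z v ∈
        Module.End.eigenspace (convolutionL2 μ w : Lp ℂ 2 μ →ₗ[ℂ] Lp ℂ 2 μ) c := by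
    intro z v hv
    rw [Module.End.mem_eigenspace_iff] at hv ⊢
    rw [← map_smul, ← hv]
    change ContinuousMap.toLp 2 μ ℂ (convolution μ w (leftRegular μ z v)) =
      leftRegular μ z (ContinuousMap.toLp 2 μ ℂ (convolution μ w v))
    rw [convolution_leftRegular, leftRegular_toLp]
  obtain ⟨f, hf, hfx⟩ := exists_mem_coeffSpan_of_finiteDimensional (leftRegular μ)
    (norm_leftRegular μ) (continuous_leftRegular μ) _ hinv h hh w
  convert hf using 1
  ext x
  rw [hfx, ← inner_map_map_of_norm_map _ (norm_leftRegular μ x⁻¹) w, ← Module.End.mul_apply,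
    ← map_mul, inv_mul_cancel, map_one]
  rfl

include μ in
/-- The Peter–Weyl theorem: matrix coefficients of continuous irreducible unitary representations
span a dense subspace of the continuous functions. -/
theorem topologicalClosure_coeffSpan : (coeffSpan G).topologicalClosure = ⊤ := by
  let inv : C(G, ℂ) →L[ℂ] C(G, ℂ) :=
    ContinuousLinearMap.mk
      (ContinuousMap.compRightAlgHom ℂ ℂ ⟨fun x : G => x⁻¹, continuous_inv⟩).toLinearMap
      (ContinuousMap.continuous_precomp _)
  have hinv : ∀ f x, inv f x = f x⁻¹ := fun f x => rfl
  rw [Submodule.eq_top_iff']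
  intro φ
  rw [← SetLike.mem_coe, Submodule.topologicalClosure_coe, Metric.mem_closure_iff]
  intro ε hε
  -- The approximation is applied to `inv φ` because the convolution will be composed with inversion
  -- again.
  obtain ⟨w, hw, hwφ⟩ := exists_approximate_identity μ (inv φ) (half_pos (half_pos hε))
  let W := ContinuousMap.toLp 2 μ ℂ w
  let S : Submodule ℂ (Lp ℂ 2 μ) :=
    ⨆ c, Module.End.eigenspace (convolutionL2 μ W : Lp ℂ 2 μ →ₗ[ℂ] Lp ℂ 2 μ) c
  have hS : S ≤ (coeffSpan G).comap (inv.comp (convolution μ W) : Lp ℂ 2 μ →ₗ[ℂ] C(G, ℂ)) := by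
    refine iSup_le fun c h hh => ?_
    -- The kernel may be infinite dimensional, but it contributes nothing: a continuous function
    -- vanishing in `L²` is zero.
    by_cases hc : c = 0
    · subst hc
      rw [Module.End.mem_eigenspace_iff, zero_smul] at hh
      have h1 : ContinuousMap.toLp 2 μ ℂ (convolution μ W h) = ContinuousMap.toLp 2 μ ℂ 0 := by
        rw [map_zero]; exact hh
      have h2 : convolution μ W h = 0 := ContinuousMap.toLp_injective μ h1
      change inv (convolution μ W h) ∈ coeffSpan G
      rw [h2, map_zero]
      exact zero_mem _
    · exact convolution_mem_coeffSpan_comp_inv μ W c hc h hh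
  have hd : S.topologicalClosure = ⊤ := by
    rw [Submodule.topologicalClosure_eq_top_iff]
    exact ContinuousLinearMap.orthogonalComplement_iSup_eigenspaces_eq_bot
      (isCompactOperator_convolutionL2 μ W) (isSymmetric_convolutionL2 μ w hw)
  let g := inv.comp (convolution μ W) (ContinuousMap.toLp 2 μ ℂ (inv φ))
  have hg : dist φ g ≤ ε / 2 / 2 := by
    rw [dist_comm, ContinuousMap.dist_le (by positivity)]
    intro x
    have h1 : g x = ∫ y, starRingEnd ℂ (w y) * inv φ (x⁻¹ * y) ∂μ := by
      change convolution μ W (ContinuousMap.toLp 2 μ ℂ (inv φ)) x⁻¹ = _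
      rw [convolution_toLp, ← integral_mul_left_eq_self _ x⁻¹]
      refine integral_congr_ae (Filter.Eventually.of_forall fun y => ?_)
      simp [mul_comm]
    have h2 : φ x = inv φ x⁻¹ := by simp [hinv]
    rw [h1, h2, dist_eq_norm]
    exact hwφ x⁻¹
  have hmem : ContinuousMap.toLp 2 μ ℂ (inv φ) ∈ closure (S : Set (Lp ℂ 2 μ)) := by
    rw [← Submodule.topologicalClosure_coe, hd]; trivial
  have hgc : g ∈ closure (coeffSpan G : Set C(G, ℂ)) :=
    map_mem_closure (inv.comp (convolution μ W)).continuous hmem fun h hh => hS hh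
  obtain ⟨f, hf, hfg⟩ := Metric.mem_closure_iff.mp hgc (ε / 2) (by positivity)
  exact ⟨f, hf, (dist_triangle _ g _).trans_lt (by linarith)⟩

end PeterWeyl

/-! ### Schur's lemma and the orthogonality relations -/

section Schur

variable {G : Type*} [Group G] [TopologicalSpace G]

theorem IrrepMatrix.dim_pos (ξ : IrrepMatrix G) : 0 < ξ.dim := by
  rcases Nat.eq_zero_or_pos ξ.dim with h | h
  · exfalso
    have := ξ.irreducible
    have hE : IsEmpty (Fin ξ.dim) := by rw [h]; infer_instance
    obtain ⟨W, W', hW⟩ := (inferInstance :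
      Nontrivial (Subrepresentation (unitaryRepresentation ξ.hom)))
    refine hW (Subrepresentation.toSubmodule_injective ?_)
    exact Subsingleton.elim _ _
  · exact h

theorem IrrepMatrix.mat_mul (ξ : IrrepMatrix G) (x y : G) :
    ξ.mat (x * y) = ξ.mat x * ξ.mat y := by
  simp [IrrepMatrix.mat]

theorem IrrepMatrix.conjTranspose_mul_mat (ξ : IrrepMatrix G) (x : G) :
    (ξ.mat x)ᴴ * ξ.mat x = 1 :=
  Matrix.mem_unitaryGroup_iff'.mp (ξ.hom x).2

theorem IrrepMatrix.mat_mul_conjTranspose (ξ : IrrepMatrix G) (x : G) :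
    ξ.mat x * (ξ.mat x)ᴴ = 1 :=
  Matrix.mem_unitaryGroup_iff.mp (ξ.hom x).2

theorem IrrepMatrix.mat_inv (ξ : IrrepMatrix G) (x : G) : ξ.mat x⁻¹ = (ξ.mat x)ᴴ := by
  have h : ξ.mat x⁻¹ * ξ.mat x = 1 := by
    rw [← ξ.mat_mul, inv_mul_cancel]; simp [IrrepMatrix.mat]
  calc ξ.mat x⁻¹ = ξ.mat x⁻¹ * (ξ.mat x * (ξ.mat x)ᴴ) := by
        rw [ξ.mat_mul_conjTranspose, Matrix.mul_one]
    _ = (ξ.mat x)ᴴ := by rw [← Matrix.mul_assoc, h, Matrix.one_mul]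

theorem IrrepMatrix.continuous_mat (ξ : IrrepMatrix G) : Continuous ξ.mat :=
  continuous_subtype_val.comp ξ.continuous_hom

/-- Schur's lemma. -/
theorem IrrepMatrix.exists_eq_smul_one (ξ : IrrepMatrix G) (M : Matrix (Fin ξ.dim) (Fin ξ.dim) ℂ)
    (hM : ∀ x, M * ξ.mat x = ξ.mat x * M) : ∃ c : ℂ, M = c • 1 := by
  have : Nonempty (Fin ξ.dim) := ⟨⟨0, ξ.dim_pos⟩⟩
  obtain ⟨c, hc⟩ := Module.End.exists_eigenvalue (Matrix.toLin' M)
  have := ξ.irreducible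
  let W : Subrepresentation (unitaryRepresentation ξ.hom) :=
    { toSubmodule := Module.End.eigenspace (Matrix.toLin' M) c
      apply_mem_toSubmodule := fun g v hv => by
        rw [Module.End.mem_eigenspace_iff] at hv ⊢
        change (Matrix.toLin' M) (Matrix.toLin' (ξ.mat g) v) = c • Matrix.toLin' (ξ.mat g) v
        rw [← map_smul, ← hv, ← Module.End.mul_apply, ← Module.End.mul_apply,
          Module.End.mul_eq_comp, Module.End.mul_eq_comp, ← Matrix.toLin'_mul,
          ← Matrix.toLin'_mul, hM] }
  refine ⟨c, ?_⟩
  rcases eq_bot_or_eq_top W with h | h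
  · exact absurd (congrArg Subrepresentation.toSubmodule h) hc
  · have h1 : Module.End.eigenspace (Matrix.toLin' M) c = ⊤ :=
      congrArg Subrepresentation.toSubmodule h
    apply Matrix.toLin'.injective
    refine LinearMap.ext fun v => ?_
    have h2 : v ∈ Module.End.eigenspace (Matrix.toLin' M) c := h1 ▸ Submodule.mem_top
    rw [Module.End.mem_eigenspace_iff] at h2
    rw [h2, map_smul, Matrix.toLin'_one]
    rfl

/-- `Mᴴ * M` and `M * Mᴴ` are scalar by Schur's lemma, with the same scalar since both compute `M *
Mᴴ * M`. It is a squared column norm, hence positive, and dividing `M` by its square root gives a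
unitary intertwiner. -/
theorem IrrepMatrix.equivalent_of_intertwiner (ξ η : IrrepMatrix G)
    (M : Matrix (Fin η.dim) (Fin ξ.dim) ℂ) (hM : ∀ x, η.mat x * M = M * ξ.mat x) (hM0 : M ≠ 0) :
    IrrepMatrix.Equivalent ξ η := by
  have hMs : ∀ x, Mᴴ * η.mat x = ξ.mat x * Mᴴ := fun x => by
    have h := congrArg Matrix.conjTranspose (hM x⁻¹)
    rw [Matrix.conjTranspose_mul, Matrix.conjTranspose_mul, ← η.mat_inv, ← ξ.mat_inv, inv_inv] at h
    exact h
  obtain ⟨c, hc⟩ := ξ.exists_eq_smul_one (Mᴴ * M) fun x => by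
    rw [Matrix.mul_assoc, ← hM, ← Matrix.mul_assoc, hMs, Matrix.mul_assoc]
  obtain ⟨c', hc'⟩ := η.exists_eq_smul_one (M * Mᴴ) fun x => by
    rw [Matrix.mul_assoc, hMs, ← Matrix.mul_assoc, ← hM, Matrix.mul_assoc]
  have hcc : c = c' := by
    have h1 : c • M = c' • M := by
      calc c • M = M * (Mᴴ * M) := by rw [hc]; simp
        _ = c' • M := by rw [← Matrix.mul_assoc, hc']; simp
    exact smul_left_injective ℂ hM0 h1
  subst hcc
  let i₀ : Fin ξ.dim := ⟨0, ξ.dim_pos⟩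
  have hcsum : c = ((∑ j, ‖M j i₀‖ ^ 2 : ℝ) : ℂ) := by
    have h := congrFun (congrFun hc i₀) i₀
    rw [Matrix.mul_apply] at h
    simp only [Matrix.smul_apply, Matrix.one_apply_eq, smul_eq_mul, mul_one] at h
    rw [← h, Complex.ofReal_sum]
    refine Finset.sum_congr rfl fun j _ => ?_
    rw [Matrix.conjTranspose_apply, RCLike.star_def, Complex.conj_mul']
    push_cast
    rfl
  set s : ℝ := ∑ j, ‖M j i₀‖ ^ 2 with hs
  have hs0 : 0 ≤ s := Finset.sum_nonneg fun _ _ => by positivity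
  have hspos : 0 < s := by
    refine lt_of_le_of_ne hs0 fun h => hM0 ?_
    rw [hcsum, ← h] at hc
    simp only [Complex.ofReal_zero, zero_smul] at hc
    open scoped ComplexOrder in exact Matrix.conjTranspose_mul_self_eq_zero.mp hc
  set t : ℝ := (√s)⁻¹ with ht
  have hts : (t : ℂ) * (t * s) = 1 := by
    have h : t * (t * s) = 1 := by
      rw [ht, ← mul_assoc, ← mul_inv, Real.mul_self_sqrt hs0, inv_mul_cancel₀ hspos.ne']
    exact_mod_cast h
  have htt : star (t : ℂ) = t := Complex.conj_ofReal t
  refine ⟨(t : ℂ) • M, ?_, ?_, fun x => ?_⟩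
  · rw [Matrix.conjTranspose_smul, Matrix.smul_mul, Matrix.mul_smul, hc, smul_smul, smul_smul,
      hcsum, htt, mul_assoc, hts, one_smul]
  · rw [Matrix.conjTranspose_smul, Matrix.smul_mul, Matrix.mul_smul, hc', smul_smul, smul_smul,
      hcsum, htt, mul_assoc, hts, one_smul]
  · rw [Matrix.smul_mul, Matrix.mul_smul, hM]

variable [CompactSpace G] [MeasurableSpace G] [BorelSpace G]

theorem integrable_of_continuous (μ : Measure G) [IsFiniteMeasure μ] {E : Type*}
    [NormedAddCommGroup E] [SecondCountableTopologyEither G E] {f : G → E} (hf : Continuous f) :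
    Integrable f μ :=
  hf.integrable_of_hasCompactSupport (HasCompactSupport.of_compactSpace _)

variable [IsTopologicalGroup G] (μ : Measure G) [μ.IsHaarMeasure] [IsProbabilityMeasure μ]

theorem IrrepMatrix.continuous_mat_apply (ξ : IrrepMatrix G) (i j : Fin ξ.dim) :
    Continuous fun x => ξ.mat x i j :=
  (ξ.coeff i j).continuous

/-- The average of `η(x) E ξ(x)*` for a matrix unit `E`. -/
def averagedIntertwiner (ξ η : IrrepMatrix G) (k : Fin η.dim) (l : Fin ξ.dim) :
    Matrix (Fin η.dim) (Fin ξ.dim) ℂ :=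
  Matrix.of fun i j => ∫ x, η.mat x i k * starRingEnd ℂ (ξ.mat x j l) ∂μ

/-- Left invariance of Haar measure: substituting `z * x` moves `z` from one factor to the other. -/
theorem averagedIntertwiner_intertwines (ξ η : IrrepMatrix G) (k : Fin η.dim) (l : Fin ξ.dim)
    (z : G) : η.mat z * averagedIntertwiner μ ξ η k l =
      averagedIntertwiner μ ξ η k l * ξ.mat z := by
  have hξ := ξ.continuous_mat_apply
  have hη := η.continuous_mat_apply
  ext i j
  rw [Matrix.mul_apply, Matrix.mul_apply]
  simp only [averagedIntertwiner, Matrix.of_apply]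
  have h1 : ∑ a, η.mat z i a * ∫ x, η.mat x a k * starRingEnd ℂ (ξ.mat x j l) ∂μ =
      ∫ x, η.mat (z * x) i k * starRingEnd ℂ (ξ.mat x j l) ∂μ := by
    simp only [← integral_const_mul]
    rw [← integral_finsetSum _ fun a _ => integrable_of_continuous μ (by fun_prop)]
    refine integral_congr_ae (Filter.Eventually.of_forall fun x => ?_)
    simp only [η.mat_mul, Matrix.mul_apply, Finset.sum_mul, mul_assoc]
  have h2 : ∑ b, (∫ x, η.mat x i k * starRingEnd ℂ (ξ.mat x b l) ∂μ) * ξ.mat z b j =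
      ∫ x, η.mat x i k * starRingEnd ℂ (ξ.mat (z⁻¹ * x) j l) ∂μ := by
    simp only [← integral_mul_const]
    rw [← integral_finsetSum _ fun a _ => integrable_of_continuous μ (by fun_prop)]
    refine integral_congr_ae (Filter.Eventually.of_forall fun x => ?_)
    simp only [ξ.mat_mul, ξ.mat_inv, Matrix.mul_apply, Matrix.conjTranspose_apply, map_sum,
      map_mul, Finset.mul_sum, RCLike.star_def, Complex.conj_conj]
    exact Finset.sum_congr rfl fun b _ => by ring
  rw [h1, h2, ← integral_mul_left_eq_self
    (fun x => η.mat x i k * starRingEnd ℂ (ξ.mat (z⁻¹ * x) j l)) z]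
  simp

/-- Schur orthogonality for inequivalent representations. -/
theorem integral_coeff_mul_conj_of_not_equivalent (ξ η : IrrepMatrix G)
    (h : ¬ IrrepMatrix.Equivalent ξ η) (i k : Fin η.dim) (j l : Fin ξ.dim) :
    ∫ x, η.mat x i k * starRingEnd ℂ (ξ.mat x j l) ∂μ = 0 := by
  by_contra h0
  refine h (ξ.equivalent_of_intertwiner η _ (averagedIntertwiner_intertwines μ ξ η k l) ?_)
  intro hz
  exact h0 (congrFun (congrFun hz i) j)

/-- Schur orthogonality for the coefficients of one representation. -/
theorem integral_coeff_mul_conj (ξ : IrrepMatrix G) (i k j l : Fin ξ.dim) :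
    ∫ x, ξ.mat x i k * starRingEnd ℂ (ξ.mat x j l) ∂μ =
      (1 : Matrix (Fin ξ.dim) (Fin ξ.dim) ℂ) i j *
        (1 : Matrix (Fin ξ.dim) (Fin ξ.dim) ℂ) l k / ξ.dim := by
  have hξ := ξ.continuous_mat_apply
  obtain ⟨c, hc⟩ := ξ.exists_eq_smul_one (averagedIntertwiner μ ξ ξ k l)
    fun x => (averagedIntertwiner_intertwines μ ξ ξ k l x).symm
  have hd : (ξ.dim : ℂ) ≠ 0 := by exact_mod_cast ξ.dim_pos.ne'
  -- The trace determines the scalar: summing over the diagonal, unitarity makes the integrand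
  -- constant.
  have ht : (ξ.dim : ℂ) * c = (1 : Matrix (Fin ξ.dim) (Fin ξ.dim) ℂ) l k := by
    have h1 := congrArg Matrix.trace hc
    rw [Matrix.trace_smul, Matrix.trace_one, Fintype.card_fin, smul_eq_mul, mul_comm] at h1
    rw [← h1, Matrix.trace]
    simp only [averagedIntertwiner, Matrix.diag_apply, Matrix.of_apply]
    rw [← integral_finsetSum _ fun a _ => integrable_of_continuous μ (by fun_prop)]
    have h2 : ∀ x, ∑ a, ξ.mat x a k * starRingEnd ℂ (ξ.mat x a l) =
        (1 : Matrix (Fin ξ.dim) (Fin ξ.dim) ℂ) l k := fun x => by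
      rw [← ξ.conjTranspose_mul_mat x, Matrix.mul_apply]
      exact Finset.sum_congr rfl fun a _ => mul_comm _ _
    simp [h2]
  have h3 : ∫ x, ξ.mat x i k * starRingEnd ℂ (ξ.mat x j l) ∂μ =
      c * (1 : Matrix (Fin ξ.dim) (Fin ξ.dim) ℂ) i j := congrFun (congrFun hc i) j
  rw [h3, ← ht]
  field_simp

theorem integral_sandwich_mul_conj_of_not_equivalent (ξ η : IrrepMatrix G)
    (h : ¬ IrrepMatrix.Equivalent ξ η) (i k : Fin η.dim) (P Q : Matrix (Fin ξ.dim) (Fin ξ.dim) ℂ)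
    (j l : Fin ξ.dim) :
    ∫ x, η.mat x i k * starRingEnd ℂ ((P * ξ.mat x * Q) j l) ∂μ = 0 := by
  have hξ := ξ.continuous_mat_apply
  have hη := η.continuous_mat_apply
  simp only [Matrix.mul_apply, Finset.sum_mul, map_sum, map_mul, Finset.mul_sum]
  rw [integral_finsetSum _ fun a _ => integrable_of_continuous μ (by fun_prop)]
  refine Finset.sum_eq_zero fun a _ => ?_
  rw [integral_finsetSum _ fun a _ => integrable_of_continuous μ (by fun_prop)]
  refine Finset.sum_eq_zero fun b _ => ?_
  rw [← mul_zero (starRingEnd ℂ (P j b) * starRingEnd ℂ (Q a l)),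
    ← integral_coeff_mul_conj_of_not_equivalent μ ξ η h i k b a, ← integral_const_mul]
  exact integral_congr_ae (Filter.Eventually.of_forall fun x => by ring)

theorem integral_coeff_mul_conj_sandwich (ξ : IrrepMatrix G) (i k : Fin ξ.dim)
    (P Q : Matrix (Fin ξ.dim) (Fin ξ.dim) ℂ) (j l : Fin ξ.dim) :
    ∫ x, ξ.mat x i k * starRingEnd ℂ ((P * ξ.mat x * Q) j l) ∂μ =
      starRingEnd ℂ (P j i) * starRingEnd ℂ (Q k l) / ξ.dim := by
  have hξ := ξ.continuous_mat_apply
  simp only [Matrix.mul_apply, Finset.sum_mul, map_sum, map_mul, Finset.mul_sum]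
  rw [integral_finsetSum _ fun a _ => integrable_of_continuous μ (by fun_prop)]
  have h : ∀ a b, ∫ x, ξ.mat x i k * (starRingEnd ℂ (P j b) * starRingEnd ℂ (ξ.mat x b a) *
      starRingEnd ℂ (Q a l)) ∂μ = starRingEnd ℂ (P j b) * starRingEnd ℂ (Q a l) *
      ((1 : Matrix (Fin ξ.dim) (Fin ξ.dim) ℂ) i b *
        (1 : Matrix (Fin ξ.dim) (Fin ξ.dim) ℂ) a k / ξ.dim) := fun a b => by
    rw [← integral_coeff_mul_conj μ, ← integral_const_mul]
    exact integral_congr_ae (Filter.Eventually.of_forall fun x => by ring)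
  have h' : ∀ a, ∫ x, ∑ b, ξ.mat x i k * (starRingEnd ℂ (P j b) * starRingEnd ℂ (ξ.mat x b a) *
      starRingEnd ℂ (Q a l)) ∂μ = ∑ b, starRingEnd ℂ (P j b) * starRingEnd ℂ (Q a l) *
      ((1 : Matrix (Fin ξ.dim) (Fin ξ.dim) ℂ) i b *
        (1 : Matrix (Fin ξ.dim) (Fin ξ.dim) ℂ) a k / ξ.dim) := fun a => by
    rw [integral_finsetSum _ fun a _ => integrable_of_continuous μ (by fun_prop)]
    exact Finset.sum_congr rfl fun b _ => h a b
  simp only [h']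
  simp [Matrix.one_apply, div_eq_mul_inv]

theorem integral_norm_sq_sandwich (ξ : IrrepMatrix G) (P Q : Matrix (Fin ξ.dim) (Fin ξ.dim) ℂ)
    (hP : P * Pᴴ = 1) (hQ : Qᴴ * Q = 1) (i k : Fin ξ.dim) :
    ∫ x, ‖(P * ξ.mat x * Q) i k‖ ^ 2 ∂μ = 1 / ξ.dim := by
  have hξ := ξ.continuous_mat_apply
  have hc : Continuous fun x => (P * ξ.mat x * Q) i k := by
    simp only [Matrix.mul_apply]; fun_prop
  have key : ∫ x, (P * ξ.mat x * Q) i k * starRingEnd ℂ ((P * ξ.mat x * Q) i k) ∂μ =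
      1 / ξ.dim := by
    have h1 : ∀ x, (P * ξ.mat x * Q) i k * starRingEnd ℂ ((P * ξ.mat x * Q) i k) =
        ∑ a, ∑ b, P i b * Q a k * (ξ.mat x b a * starRingEnd ℂ ((P * ξ.mat x * Q) i k)) := by
      intro x
      generalize starRingEnd ℂ ((P * ξ.mat x * Q) i k) = z
      rw [Matrix.mul_apply]
      simp only [Matrix.mul_apply (M := P), Finset.sum_mul]
      exact Finset.sum_congr rfl fun a _ => Finset.sum_congr rfl fun b _ => by ring
    simp only [h1]
    rw [integral_finsetSum _ fun a _ => integrable_of_continuous μ (by fun_prop)]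
    have h2 : ∀ a, ∫ x, ∑ b, P i b * Q a k * (ξ.mat x b a *
        starRingEnd ℂ ((P * ξ.mat x * Q) i k)) ∂μ = ∑ b, P i b * Q a k *
          (starRingEnd ℂ (P i b) * starRingEnd ℂ (Q a k) / ξ.dim) := fun a => by
      rw [integral_finsetSum _ fun a _ => integrable_of_continuous μ (by fun_prop)]
      refine Finset.sum_congr rfl fun b _ => ?_
      rw [integral_const_mul, integral_coeff_mul_conj_sandwich]
    simp only [h2]
    have hP' := congrFun (congrFun hP i) i
    have hQ' := congrFun (congrFun hQ k) k
    rw [Matrix.mul_apply, Matrix.one_apply_eq] at hP' hQ'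
    simp only [Matrix.conjTranspose_apply, RCLike.star_def] at hP' hQ'
    calc _ = (∑ b, P i b * starRingEnd ℂ (P i b)) * (∑ a, starRingEnd ℂ (Q a k) * Q a k) /
          ξ.dim := by
          rw [Finset.sum_mul_sum, Finset.sum_comm, Finset.sum_div]
          refine Finset.sum_congr rfl fun a _ => ?_
          rw [Finset.sum_div]
          exact Finset.sum_congr rfl fun b _ => by ring
      _ = _ := by rw [hP', hQ', mul_one]
  have h3 : ∀ x, (P * ξ.mat x * Q) i k * starRingEnd ℂ ((P * ξ.mat x * Q) i k) =
      ((‖(P * ξ.mat x * Q) i k‖ ^ 2 : ℝ) : ℂ) := fun x => by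
    rw [Complex.mul_conj']; push_cast; rfl
  simp only [h3] at key
  apply Complex.ofReal_injective
  refine (integral_complex_ofReal.symm.trans (key.trans ?_))
  push_cast
  rfl

end Schur

/-! ### Random signs and bases with small coordinate moments -/

section RandomBasis

theorem pow_two_mul_le_factorial_mul_exp_add (y : ℝ) (m : ℕ) :
    y ^ (2 * m) ≤ (2 * m).factorial * (Real.exp y + Real.exp (-y)) := by
  have h1 : |y| ^ (2 * m) / (2 * m).factorial ≤ Real.exp |y| :=
    Real.pow_div_factorial_le_exp _ (abs_nonneg y) _
  have h2 : Real.exp |y| ≤ Real.exp y + Real.exp (-y) := by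
    rcases abs_cases y with ⟨h, _⟩ | ⟨h, _⟩ <;> rw [h] <;>
      linarith [Real.exp_pos y, Real.exp_pos (-y)]
  rw [div_le_iff₀ (by positivity)] at h1
  rw [(even_two_mul m).pow_abs] at h1
  calc y ^ (2 * m) ≤ Real.exp |y| * (2 * m).factorial := h1
    _ ≤ _ := by rw [mul_comm]; gcongr

/-- The sign attached to a Boolean. -/
def boolSign (e : Bool) : ℝ := if e then 1 else -1

/-- Independence of the signs factors the sum into hyperbolic cosines, and `cosh y ≤ exp (y² / 2)`.
-/
theorem sum_exp_signed_sum_le {d : ℕ} (b : Fin d → ℝ) :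
    ∑ ε : Fin d → Bool, Real.exp (∑ j, boolSign (ε j) * b j) ≤
      2 ^ d * Real.exp ((∑ j, b j ^ 2) / 2) := by
  have h1 : ∑ ε : Fin d → Bool, Real.exp (∑ j, boolSign (ε j) * b j) =
      ∏ j, ∑ e : Bool, Real.exp (boolSign e * b j) := by
    rw [Finset.prod_univ_sum, Fintype.piFinset_univ]
    simp only [Real.exp_sum]
  rw [h1, Finset.sum_div, Real.exp_sum]
  calc ∏ j, ∑ e : Bool, Real.exp (boolSign e * b j)
      ≤ ∏ j : Fin d, (2 * Real.exp (b j ^ 2 / 2)) := by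
        refine Finset.prod_le_prod (fun j _ => by positivity) fun j _ => ?_
        have h := Real.cosh_le_exp_half_sq (b j)
        rw [Real.cosh_eq] at h
        simp [boolSign]
        linarith
    _ = _ := by rw [Finset.prod_mul_distrib]; simp

/-- The constant in the moment inequality for random signs. -/
def khintchineConst (m : ℕ) : ℝ := (2 * m).factorial * (2 * Real.exp (1 / 2))

theorem khintchineConst_nonneg (m : ℕ) : 0 ≤ khintchineConst m := by
  unfold khintchineConst; positivity

/-- Khintchine's inequality for even moments: rescale to `B = 1`, dominate the power by exponentials
and use the subgaussian bound. For `B = 0` both sides vanish because `m ≠ 0`. -/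
theorem sum_signed_sum_pow_le {d : ℕ} (b : Fin d → ℝ) {B : ℝ} (hB : ∑ j, b j ^ 2 ≤ B) (m : ℕ)
    (hm : m ≠ 0) :
    ∑ ε : Fin d → Bool, (∑ j, boolSign (ε j) * b j) ^ (2 * m) ≤
      2 ^ d * (khintchineConst m * B ^ m) := by
  have hb0 : 0 ≤ ∑ j, b j ^ 2 := Finset.sum_nonneg fun _ _ => sq_nonneg _
  rcases (hb0.trans hB).eq_or_lt with hB0 | hB0
  · have hb : ∀ j, b j = 0 := fun j => by
      have := (Finset.sum_eq_zero_iff_of_nonneg fun j _ => sq_nonneg (b j)).mp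
        (le_antisymm (hB.trans hB0.symm.le) hb0) j (Finset.mem_univ j)
      exact pow_eq_zero_iff two_ne_zero |>.mp this
    simp [hb, ← hB0, hm]
  · set t := (√B)⁻¹ with ht
    have htB : t ^ 2 * B = 1 := by
      rw [ht, inv_pow, Real.sq_sqrt hB0.le, inv_mul_cancel₀ hB0.ne']
    have h1 : ∀ s : ℝ, (s = 1 ∨ s = -1) → ∑ ε : Fin d → Bool,
        Real.exp (s * (t * ∑ j, boolSign (ε j) * b j)) ≤ 2 ^ d * Real.exp (1 / 2) := by
      intro s hs
      have h := sum_exp_signed_sum_le fun j => s * (t * b j)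
      have h2 : ∀ ε : Fin d → Bool, ∑ j, boolSign (ε j) * (s * (t * b j)) =
          s * (t * ∑ j, boolSign (ε j) * b j) := fun ε => by
        rw [Finset.mul_sum, Finset.mul_sum]
        exact Finset.sum_congr rfl fun j _ => by ring
      simp only [h2] at h
      refine h.trans ?_
      gcongr
      have h3 : ∑ j, (s * (t * b j)) ^ 2 = t ^ 2 * ∑ j, b j ^ 2 := by
        rw [Finset.mul_sum]
        refine Finset.sum_congr rfl fun j _ => ?_
        rcases hs with rfl | rfl <;> ring
      rw [h3, ← htB]
      gcongr
    have h2 : ∑ ε : Fin d → Bool, (t * ∑ j, boolSign (ε j) * b j) ^ (2 * m) ≤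
        2 ^ d * khintchineConst m := by
      calc _ ≤ ∑ ε : Fin d → Bool, ((2 * m).factorial : ℝ) *
            (Real.exp (1 * (t * ∑ j, boolSign (ε j) * b j)) +
              Real.exp ((-1) * (t * ∑ j, boolSign (ε j) * b j))) := by
            refine Finset.sum_le_sum fun ε _ => ?_
            rw [one_mul, neg_one_mul]
            exact pow_two_mul_le_factorial_mul_exp_add _ _
        _ ≤ ((2 * m).factorial : ℝ) * (2 ^ d * Real.exp (1 / 2) + 2 ^ d * Real.exp (1 / 2)) := by
            rw [← Finset.mul_sum, Finset.sum_add_distrib]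
            gcongr
            · exact h1 1 (Or.inl rfl)
            · exact h1 (-1) (Or.inr rfl)
        _ = _ := by unfold khintchineConst; ring
    simp only [mul_pow, ← Finset.mul_sum] at h2
    have h3 : t ^ (2 * m) * B ^ m = 1 := by rw [pow_mul, ← mul_pow, htB, one_pow]
    calc _ = B ^ m * (t ^ (2 * m) * ∑ ε : Fin d → Bool,
          (∑ j, boolSign (ε j) * b j) ^ (2 * m)) := by
          rw [← mul_assoc, mul_comm (B ^ m), h3, one_mul]
      _ ≤ B ^ m * (2 ^ d * khintchineConst m) := by gcongr
      _ = _ := by ring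

/-- A moment inequality for random signs with complex coefficients. -/
theorem sum_norm_signed_sum_pow_le {d : ℕ} (a : Fin d → ℂ) {B : ℝ} (hB : ∑ j, ‖a j‖ ^ 2 ≤ B)
    (m : ℕ) (hm : m ≠ 0) :
    ∑ ε : Fin d → Bool, ‖∑ j, (boolSign (ε j) : ℂ) * a j‖ ^ (2 * m) ≤
      2 ^ d * (2 ^ m * khintchineConst m * B ^ m) := by
  have hre : ∑ j, (a j).re ^ 2 ≤ B := (Finset.sum_le_sum fun j _ => by
    rw [← Complex.normSq_eq_norm_sq, Complex.normSq_apply]; nlinarith [sq_nonneg (a j).im]).trans hB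
  have him : ∑ j, (a j).im ^ 2 ≤ B := (Finset.sum_le_sum fun j _ => by
    rw [← Complex.normSq_eq_norm_sq, Complex.normSq_apply]; nlinarith [sq_nonneg (a j).re]).trans hB
  have h1 : ∀ z : ℂ, ‖z‖ ^ (2 * m) ≤ 2 ^ (m - 1) * (z.re ^ (2 * m) + z.im ^ (2 * m)) := fun z => by
    rw [pow_mul, ← Complex.normSq_eq_norm_sq, Complex.normSq_apply, ← sq, ← sq, pow_mul, pow_mul]
    exact add_pow_le (sq_nonneg _) (sq_nonneg _) m
  calc _ ≤ ∑ ε : Fin d → Bool, 2 ^ (m - 1) * ((∑ j, boolSign (ε j) * (a j).re) ^ (2 * m) +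
        (∑ j, boolSign (ε j) * (a j).im) ^ (2 * m)) := by
        refine Finset.sum_le_sum fun ε _ => (h1 _).trans (le_of_eq ?_)
        simp [Complex.re_sum, Complex.im_sum]
    _ ≤ 2 ^ (m - 1) * (2 ^ d * (khintchineConst m * B ^ m) +
        2 ^ d * (khintchineConst m * B ^ m)) := by
        rw [← Finset.mul_sum, Finset.sum_add_distrib]
        gcongr
        · exact sum_signed_sum_pow_le _ hre m hm
        · exact sum_signed_sum_pow_le _ him m hm
    _ = _ := by
        obtain ⟨k, rfl⟩ := Nat.exists_eq_succ_of_ne_zero hm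
        simp only [Nat.succ_sub_one, pow_succ]
        ring

/-- A unitary matrix all of whose entries have modulus `1 / √d` (the Fourier matrix). -/
theorem exists_flat_unitary {d : ℕ} (hd : 0 < d) :
    ∃ F : Matrix (Fin d) (Fin d) ℂ, F * Fᴴ = 1 ∧ ∀ i j, ‖F i j‖ ^ 2 = 1 / d := by
  let ζ : ℂ := Complex.exp (2 * Real.pi * Complex.I / d)
  have hζ : IsPrimitiveRoot ζ d := Complex.isPrimitiveRoot_exp d hd.ne'
  have hζn : ‖ζ‖ = 1 := hζ.norm'_eq_one hd.ne'
  have hd' : (0 : ℝ) < d := by exact_mod_cast hd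
  let t : ℝ := (√d)⁻¹
  have ht : t ^ 2 = 1 / d := by simp [t]
  refine ⟨Matrix.of fun i j => (t : ℂ) * ζ ^ (i.1 * j.1), ?_, fun i j => ?_⟩
  · ext i k
    rw [Matrix.mul_apply]
    simp only [Matrix.of_apply, Matrix.conjTranspose_apply, RCLike.star_def, map_mul, map_pow,
      Complex.conj_ofReal]
    have hconj : starRingEnd ℂ ζ = ζ⁻¹ := (Complex.inv_eq_conj hζn).symm
    have h1 : ∀ j : Fin d, (t : ℂ) * ζ ^ (i.1 * j.1) * (t * (starRingEnd ℂ ζ) ^ (k.1 * j.1)) =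
        (1 / d : ℂ) * (ζ ^ i.1 * (ζ ^ k.1)⁻¹) ^ j.1 := fun j => by
      have : (t : ℂ) * t = 1 / d := by
        rw [← sq, ← Complex.ofReal_pow, ht]; push_cast; rfl
      rw [hconj, mul_pow, ← this, pow_mul, pow_mul, inv_pow]
      ring
    simp only [h1]
    rw [← Finset.mul_sum, Fin.sum_univ_eq_sum_range (fun j => (ζ ^ i.1 * (ζ ^ k.1)⁻¹) ^ j)]
    have hζ0 : ζ ≠ 0 := hζ.ne_zero hd.ne'
    by_cases hik : i = k
    · subst hik
      rw [mul_inv_cancel₀ (pow_ne_zero _ hζ0)]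
      have : (d : ℂ) ≠ 0 := by exact_mod_cast hd.ne'
      simp [this]
    · rw [Matrix.one_apply_ne hik]
      have hne : ζ ^ i.1 * (ζ ^ k.1)⁻¹ ≠ 1 := fun h => by
        rw [mul_inv_eq_one₀ (pow_ne_zero _ hζ0)] at h
        exact hik (Fin.ext (hζ.pow_inj i.2 k.2 h))
      have hpow : (ζ ^ i.1 * (ζ ^ k.1)⁻¹) ^ d = 1 := by
        have h : ∀ n, (ζ ^ n) ^ d = 1 := fun n => by
          rw [← pow_mul, mul_comm, pow_mul, hζ.pow_eq_one, one_pow]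
        rw [mul_pow, inv_pow, h, h, inv_one, one_mul]
      rw [geom_sum_eq hne, hpow]
      simp
  · simp only [Matrix.of_apply, norm_mul, norm_pow, hζn, one_pow, mul_one, Complex.norm_real]
    rw [Real.norm_eq_abs, sq_abs, ht]

/-- In a suitable orthonormal basis, all the moments of the coordinates of a bounded vector-valued
function are as small as for an equidistributed one. -/
theorem exists_unitary_sum_integral_pow_le {X : Type*} [MeasurableSpace X] (μ : Measure X)
    [IsProbabilityMeasure μ] {d : ℕ} (hd : 0 < d) (m : ℕ) (hm : m ≠ 0) (a : X → Fin d → ℂ) (s : ℝ)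
    (ha : ∀ x, ∑ j, ‖a x j‖ ^ 2 ≤ s ^ 2)
    (hint : ∀ c : Fin d → ℂ, Integrable (fun x => ‖∑ j, c j * a x j‖ ^ (2 * m)) μ) :
    ∃ W : Matrix (Fin d) (Fin d) ℂ, W * Wᴴ = 1 ∧
      ∑ i, ∫ x, ‖(W *ᵥ a x) i‖ ^ (2 * m) ∂μ ≤
        d * (2 ^ m * khintchineConst m * (s ^ 2 / d) ^ m) := by
  obtain ⟨F, hF, hFn⟩ := exists_flat_unitary hd
  -- Entries of `F` have modulus `1 / √d`, so each coordinate of `F * D ε` applied to `a x` is a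
  -- signed sum whose coefficients have square sum at most `s ^ 2 / d`.
  let D : (Fin d → Bool) → Matrix (Fin d) (Fin d) ℂ := fun ε =>
    Matrix.diagonal fun j => (boolSign (ε j) : ℂ)
  have hD : ∀ ε, D ε * (D ε)ᴴ = 1 := fun ε => by
    rw [Matrix.diagonal_conjTranspose, Matrix.diagonal_mul_diagonal, ← Matrix.diagonal_one]
    congr 1
    ext j
    simp only [Pi.star_apply, RCLike.star_def, Complex.conj_ofReal]
    by_cases h : ε j <;> simp [boolSign, h]
  have hW : ∀ ε, (F * D ε) * (F * D ε)ᴴ = 1 := fun ε => by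
    rw [Matrix.conjTranspose_mul, Matrix.mul_assoc, ← Matrix.mul_assoc (D ε), hD, Matrix.one_mul,
      hF]
  have hrow : ∀ ε x i, ((F * D ε) *ᵥ a x) i = ∑ j, (boolSign (ε j) : ℂ) * (F i j * a x j) := by
    intro ε x i
    simp only [Matrix.mulVec, dotProduct]
    refine Finset.sum_congr rfl fun j _ => ?_
    rw [Matrix.mul_diagonal]
    ring
  have hintε : ∀ ε i, Integrable (fun x => ‖((F * D ε) *ᵥ a x) i‖ ^ (2 * m)) μ := fun ε i =>
    hint ((F * D ε) i)
  have hsum : ∑ ε : Fin d → Bool, ∑ i, ∫ x, ‖((F * D ε) *ᵥ a x) i‖ ^ (2 * m) ∂μ ≤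
      ∑ _ε : Fin d → Bool, (d * (2 ^ m * khintchineConst m * (s ^ 2 / d) ^ m) : ℝ) := by
    rw [Finset.sum_comm]
    have h1 : ∀ i, ∑ ε : Fin d → Bool, ∫ x, ‖((F * D ε) *ᵥ a x) i‖ ^ (2 * m) ∂μ ≤
        2 ^ d * (2 ^ m * khintchineConst m * (s ^ 2 / d) ^ m) := fun i => by
      rw [← integral_finsetSum _ fun ε _ => hintε ε i]
      have h2 : ∀ x, ∑ ε : Fin d → Bool, ‖((F * D ε) *ᵥ a x) i‖ ^ (2 * m) ≤
          2 ^ d * (2 ^ m * khintchineConst m * (s ^ 2 / d) ^ m) := fun x => by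
        simp only [hrow]
        refine sum_norm_signed_sum_pow_le _ ?_ m hm
        simp only [norm_mul, mul_pow, hFn, ← Finset.mul_sum]
        rw [one_div, inv_mul_eq_div]
        gcongr
        exact ha x
      refine (integral_mono (integrable_finsetSum _ fun ε _ => hintε ε i)
        (integrable_const _) h2).trans (le_of_eq ?_)
      simp
    refine (Finset.sum_le_sum fun i _ => h1 i).trans (le_of_eq ?_)
    simp only [Finset.sum_const, Finset.card_univ, Fintype.card_fin, nsmul_eq_mul,
      Fintype.card_pi, Fintype.card_bool, Finset.prod_const]
    push_cast
    ring
  -- Some choice of signs does no worse than the average.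
  obtain ⟨ε, _, hε⟩ := Finset.exists_le_of_sum_le Finset.univ_nonempty hsum
  exact ⟨F * D ε, hW ε, hε⟩

end RandomBasis

/-! ### Singular values and Schatten norms -/

section SingularValues

variable {d : ℕ}

theorem sum_norm_sq_eq_conjTranspose_mul (A : Matrix (Fin d) (Fin d) ℂ) (k : Fin d) :
    ((∑ j, ‖A j k‖ ^ 2 : ℝ) : ℂ) = (Aᴴ * A) k k := by
  rw [Matrix.mul_apply, Complex.ofReal_sum]
  refine Finset.sum_congr rfl fun j _ => ?_
  rw [Matrix.conjTranspose_apply, RCLike.star_def, Complex.conj_mul']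
  push_cast
  rfl

/-- Right singular vectors and singular values of a matrix. -/
theorem exists_singular_basis (M : Matrix (Fin d) (Fin d) ℂ) :
    ∃ (V : Matrix (Fin d) (Fin d) ℂ) (s : Fin d → ℝ), V * Vᴴ = 1 ∧ (∀ k, 0 ≤ s k) ∧
      (∀ U : Matrix (Fin d) (Fin d) ℂ, Uᴴ * U = 1 → ∀ k,
        ∑ j, ‖(U * M * V) j k‖ ^ 2 = s k ^ 2) ∧
      ∀ r : ℝ, 0 < r → schattenNorm r M ^ r = ∑ k, s k ^ r := by
  have hH : (Mᴴ * M).IsHermitian := Matrix.isHermitian_conjTranspose_mul_self M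
  let V : Matrix (Fin d) (Fin d) ℂ := hH.eigenvectorUnitary
  have hV : Vᴴ * V = 1 := Matrix.mem_unitaryGroup_iff'.mp hH.eigenvectorUnitary.2
  have hV' : V * Vᴴ = 1 := Matrix.mem_unitaryGroup_iff.mp hH.eigenvectorUnitary.2
  have hdiag : Vᴴ * (Mᴴ * M) * V = Matrix.diagonal (RCLike.ofReal ∘ hH.eigenvalues) := by
    have h := hH.conjStarAlgAut_star_eigenvectorUnitary
    rw [Unitary.conjStarAlgAut_star_apply] at h
    exact h
  have hU : ∀ U : Matrix (Fin d) (Fin d) ℂ, Uᴴ * U = 1 → ∀ k,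
      ∑ j, ‖(U * M * V) j k‖ ^ 2 = hH.eigenvalues k := by
    intro U hU k
    apply Complex.ofReal_injective
    rw [sum_norm_sq_eq_conjTranspose_mul]
    have h : (U * M * V)ᴴ * (U * M * V) = Vᴴ * (Mᴴ * M) * V := by
      calc (U * M * V)ᴴ * (U * M * V) = Vᴴ * (Mᴴ * ((Uᴴ * U) * M)) * V := by
            simp only [Matrix.conjTranspose_mul, Matrix.mul_assoc]
        _ = _ := by rw [hU, Matrix.one_mul]
    rw [h, hdiag, Matrix.diagonal_apply_eq]
    rfl
  have hnn : ∀ k, 0 ≤ hH.eigenvalues k := fun k => by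
    rw [← hU 1 (by simp) k]
    positivity
  refine ⟨V, fun k => √(hH.eigenvalues k), hV', fun k => Real.sqrt_nonneg _, fun U hU' k => ?_,
    fun r hr => ?_⟩
  · rw [Real.sq_sqrt (hnn k), hU U hU' k]
  · have htr : Matrix.trace (cfc (fun t : ℝ => √t ^ r) (Mᴴ * M)) =
        ((∑ k, √(hH.eigenvalues k) ^ r : ℝ) : ℂ) := by
      rw [hH.cfc_eq, Matrix.IsHermitian.cfc, Unitary.conjStarAlgAut_apply, Matrix.trace_mul_comm,
        ← Matrix.mul_assoc]
      change Matrix.trace (Vᴴ * V * _) = _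
      rw [hV, Matrix.one_mul, Matrix.trace_diagonal, Complex.ofReal_sum]
      rfl
    rw [schattenNorm, htr, Complex.ofReal_re, ← Real.rpow_mul (Finset.sum_nonneg fun k _ =>
      Real.rpow_nonneg (Real.sqrt_nonneg _) _), one_div_mul_cancel hr.ne', Real.rpow_one]

theorem sum_norm_le_sqrt_card_mul (v : Fin d → ℂ) (hv : ∑ j, ‖v j‖ ^ 2 = 1) :
    ∑ j, ‖v j‖ ≤ √d := by
  apply Real.le_sqrt_of_sq_le
  have h := sq_sum_le_card_mul_sum_sq (s := Finset.univ) (f := fun j => ‖v j‖)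
  rw [hv] at h
  simpa using h

/-- The `ℓ²` operator norm is at most `√d` times the maximal column sum. -/
theorem le_sqrt_card_mul_opNormLinfty (M V : Matrix (Fin d) (Fin d) ℂ) (hV : V * Vᴴ = 1)
    (k : Fin d) (s : ℝ) (hs : 0 ≤ s) (h : ∑ j, ‖(M * V) j k‖ ^ 2 = s ^ 2) :
    s ≤ √d * opNormLinfty Mᵀ := by
  have hV' : Vᴴ * V = 1 := mul_eq_one_comm.mp hV
  have hVk : ∑ j, ‖V j k‖ ^ 2 = 1 := by
    apply Complex.ofReal_injective
    rw [sum_norm_sq_eq_conjTranspose_mul, hV', Matrix.one_apply_eq, Complex.ofReal_one]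
  have h0 : 0 ≤ ∑ j, ‖(M * V) j k‖ := Finset.sum_nonneg fun _ _ => norm_nonneg _
  -- `ℓ² ≤ ℓ¹` on the output; on the input, the unit column of `V` has `ℓ¹` norm at most `√d`.
  have h1 : s ≤ ∑ j, ‖(M * V) j k‖ := by
    refine (sq_le_sq₀ hs h0).mp ?_
    rw [← h]
    exact Finset.sum_sq_le_sq_sum_of_nonneg fun _ _ => norm_nonneg _
  refine h1.trans ?_
  calc ∑ j, ‖(M * V) j k‖ ≤ ∑ j, ∑ l, ‖M j l‖ * ‖V l k‖ := by
        refine Finset.sum_le_sum fun j _ => ?_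
        rw [Matrix.mul_apply]
        refine (norm_sum_le _ _).trans (le_of_eq ?_)
        simp only [norm_mul]
    _ = ∑ l, (∑ j, ‖Mᵀ l j‖) * ‖V l k‖ := by
        rw [Finset.sum_comm]
        simp only [Finset.sum_mul, Matrix.transpose_apply]
    _ ≤ ∑ l, opNormLinfty Mᵀ * ‖V l k‖ := by
        refine Finset.sum_le_sum fun l _ => mul_le_mul_of_nonneg_right ?_ (norm_nonneg _)
        exact le_ciSup (f := fun l => ∑ j, ‖Mᵀ l j‖) (Set.finite_range _).bddAbove l
    _ = (∑ l, ‖V l k‖) * opNormLinfty Mᵀ := by rw [← Finset.mul_sum, mul_comm]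
    _ ≤ _ := by
        refine mul_le_mul_of_nonneg_right (sum_norm_le_sqrt_card_mul _ hVk) ?_
        exact Real.iSup_nonneg fun i => Finset.sum_nonneg fun _ _ => norm_nonneg _

/-- Concavity of `t ↦ t ^ q`, through its tangent line at `K` (Bernoulli's inequality). -/
theorem sum_rpow_le_of_sum_le (I : Fin d → ℝ) (hI : ∀ i, 0 ≤ I i) {K : ℝ} (hK : 0 ≤ K)
    (hsum : ∑ i, I i ≤ d * K) {q : ℝ} (hq : 0 < q) (hq1 : q ≤ 1) :
    ∑ i, I i ^ q ≤ d * K ^ q := by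
  rcases hK.eq_or_lt with rfl | hK
  · have h0 : ∀ i, I i = 0 := fun i =>
      (Finset.sum_eq_zero_iff_of_nonneg fun i _ => hI i).mp
        (le_antisymm (by simpa using hsum) (Finset.sum_nonneg fun i _ => hI i)) i
          (Finset.mem_univ i)
    simp [h0, Real.zero_rpow hq.ne']
  · have h1 : ∀ i, I i ^ q ≤ K ^ q * (1 + q * (I i / K - 1)) := fun i => by
      have hd : 0 ≤ I i / K := div_nonneg (hI i) hK.le
      have h := rpow_one_add_le_one_add_mul_self (s := I i / K - 1) (by linarith) hq.le hq1
      rw [add_sub_cancel, Real.div_rpow (hI i) hK.le, div_le_iff₀' (Real.rpow_pos_of_pos hK q)] at h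
      exact h
    have h2 : ∑ i, (1 + q * (I i / K - 1)) ≤ d := by
      have h3 : ∑ i, (1 + q * (I i / K - 1)) = d + q * ((∑ i, I i) / K - d) := by
        rw [Finset.sum_add_distrib, ← Finset.mul_sum, Finset.sum_sub_distrib, Finset.sum_div]
        simp
      have h4 : (∑ i, I i) / K ≤ d := by rwa [div_le_iff₀ hK]
      rw [h3]
      nlinarith
    calc _ ≤ ∑ i, K ^ q * (1 + q * (I i / K - 1)) := Finset.sum_le_sum fun i _ => h1 i
      _ = K ^ q * ∑ i, (1 + q * (I i / K - 1)) := by rw [Finset.mul_sum]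
      _ ≤ K ^ q * d := by gcongr
      _ = _ := mul_comm _ _

end SingularValues

/-! ### Norms of continuous functions and of integral functionals on `L^p` -/

section LpBounds

variable {G : Type*} [TopologicalSpace G] [CompactSpace G] [MeasurableSpace G] [BorelSpace G]
  (μ : Measure G) [IsProbabilityMeasure μ]

theorem norm_toLp_le_integral_pow_rpow (p : ℝ≥0∞) [Fact (1 ≤ p)] (m : ℕ) (hm : m ≠ 0)
    (hp : p ≤ (2 * m : ℕ)) (g : C(G, ℂ)) :
    ‖ContinuousMap.toLp p μ ℂ g‖ ≤ (∫ x, ‖g x‖ ^ (2 * m) ∂μ) ^ ((1 : ℝ) / (2 * m : ℕ)) := by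
  have hmem : MemLp g ((2 * m : ℕ) : ℝ≥0∞) μ :=
    g.continuous.memLp_of_hasCompactSupport (HasCompactSupport.of_compactSpace _)
  rw [Lp.norm_def, eLpNorm_congr_ae (ContinuousMap.coeFn_toLp μ g)]
  refine ENNReal.toReal_le_of_le_ofReal (Real.rpow_nonneg (integral_nonneg fun x => by positivity) _)
    ((eLpNorm_le_eLpNorm_of_exponent_le hp g.continuous.aestronglyMeasurable).trans (le_of_eq ?_))
  rw [hmem.eLpNorm_eq_integral_rpow_norm (by simpa using hm) (ENNReal.natCast_ne_top _)]
  simp only [ENNReal.toReal_natCast, Real.rpow_natCast, one_div]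

theorem norm_Lp_one_le (p : ℝ≥0∞) [Fact (1 ≤ p)] (f : Lp ℂ p μ) : ∫ x, ‖f x‖ ∂μ ≤ ‖f‖ := by
  rw [integral_norm_eq_lintegral_enorm (Lp.aestronglyMeasurable f), Lp.norm_def]
  refine ENNReal.toReal_mono (Lp.eLpNorm_ne_top f) ?_
  rw [← eLpNorm_one_eq_lintegral_enorm]
  exact eLpNorm_le_eLpNorm_of_exponent_le Fact.out (Lp.aestronglyMeasurable f)

theorem integrable_Lp_mul (p : ℝ≥0∞) [Fact (1 ≤ p)] (f : Lp ℂ p μ) (g : C(G, ℂ)) :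
    Integrable (fun x => f x * starRingEnd ℂ (g x)) μ := by
  refine ((Lp.memLp f).integrable Fact.out).mul_bdd (c := ‖g‖) ?_ ?_
  · exact (Complex.continuous_conj.comp g.continuous).aestronglyMeasurable
  · exact Filter.Eventually.of_forall fun x => by
      rw [RCLike.norm_conj]; exact g.norm_coe_le_norm x

/-- The functional `f ↦ ∫ f * conj g` on `L^p`. -/
def pairing (p : ℝ≥0∞) [Fact (1 ≤ p)] (g : C(G, ℂ)) : Lp ℂ p μ →L[ℂ] ℂ :=
  LinearMap.mkContinuous
    { toFun := fun f => ∫ x, f x * starRingEnd ℂ (g x) ∂μ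
      map_add' := fun f₁ f₂ => by
        rw [← integral_add (integrable_Lp_mul μ p f₁ g) (integrable_Lp_mul μ p f₂ g)]
        refine integral_congr_ae ?_
        filter_upwards [Lp.coeFn_add f₁ f₂] with x hx
        rw [hx, Pi.add_apply, add_mul]
      map_smul' := fun c f => by
        rw [RingHom.id_apply, smul_eq_mul, ← integral_const_mul]
        refine integral_congr_ae ?_
        filter_upwards [Lp.coeFn_smul c f] with x hx
        rw [hx, Pi.smul_apply, smul_eq_mul, mul_assoc] } ‖g‖ (fun f => by
    refine (norm_integral_le_integral_norm _).trans ?_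
    refine le_trans ?_ (mul_le_mul_of_nonneg_left (norm_Lp_one_le μ p f) (norm_nonneg g))
    rw [← integral_const_mul]
    refine integral_mono (integrable_Lp_mul μ p f g).norm
      (((Lp.memLp f).integrable Fact.out).norm.const_mul _) fun x => ?_
    simp only [norm_mul, RCLike.norm_conj]
    rw [mul_comm]
    gcongr
    exact g.norm_coe_le_norm x)

theorem pairing_apply (p : ℝ≥0∞) [Fact (1 ≤ p)] (g : C(G, ℂ)) (f : Lp ℂ p μ) :
    pairing μ p g f = ∫ x, f x * starRingEnd ℂ (g x) ∂μ := rfl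

theorem pairing_toLp (p : ℝ≥0∞) [Fact (1 ≤ p)] (g f : C(G, ℂ)) :
    pairing μ p g (ContinuousMap.toLp p μ ℂ f) = ∫ x, f x * starRingEnd ℂ (g x) ∂μ := by
  rw [pairing_apply]
  refine integral_congr_ae ?_
  filter_upwards [ContinuousMap.coeFn_toLp (p := p) (𝕜 := ℂ) μ f] with x hx
  rw [hx]

/-- Hölder with `P = min 2 p` and its conjugate `Q`. At `P = 1`, where `Q` would be infinite, the
sup bound gives the exponent 0 directly. -/
theorem norm_pairing_le (p : ℝ≥0∞) [Fact (1 ≤ p)] (hp : p ≠ ⊤) (g : C(G, ℂ))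
    (hg : ∀ x, ‖g x‖ ≤ 1) {d : ℝ} (hd : 0 < d) (hg2 : ∫ x, ‖g x‖ ^ 2 ∂μ ≤ 1 / d) :
    ‖pairing μ p g‖ ≤ d ^ (-1 + 1 / min 2 p.toReal) := by
  refine ContinuousLinearMap.opNorm_le_bound _ (by positivity) fun f => ?_
  rw [pairing_apply]
  refine (norm_integral_le_integral_norm _).trans ?_
  simp only [norm_mul, RCLike.norm_conj]
  have hp1 : 1 ≤ p.toReal := by
    have h := ENNReal.toReal_mono hp (Fact.out : 1 ≤ p)
    simpa using h
  set P : ℝ := min 2 p.toReal with hP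
  have hP1 : 1 ≤ P := le_min one_le_two hp1
  have hP2 : P ≤ 2 := min_le_left _ _
  rcases hP1.eq_or_lt with h1 | h1
  · rw [← h1]
    norm_num
    refine le_trans ?_ (norm_Lp_one_le μ p f)
    refine integral_mono_of_nonneg (Filter.Eventually.of_forall fun x => by positivity)
      ((Lp.memLp f).integrable Fact.out).norm (Filter.Eventually.of_forall fun x => ?_)
    exact mul_le_of_le_one_right (norm_nonneg _) (hg x)
  · have hPQ : P.HolderConjugate (Real.conjExponent P) := Real.HolderConjugate.conjExponent h1
    set Q := Real.conjExponent P with hQ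
    have hQ2 : 2 ≤ Q := by
      rw [hQ, Real.conjExponent, le_div_iff₀ (by linarith)]
      linarith
    have hPp : ENNReal.ofReal P ≤ p :=
      ENNReal.ofReal_le_of_le_toReal (min_le_right _ _)
    have hfP : MemLp f (ENNReal.ofReal P) μ := (Lp.memLp f).mono_exponent hPp
    have hgQ : MemLp g (ENNReal.ofReal Q) μ :=
      g.continuous.memLp_of_hasCompactSupport (HasCompactSupport.of_compactSpace _)
    refine (integral_mul_norm_le_Lp_mul_Lq hPQ hfP hgQ).trans ?_
    have hf' : (∫ x, ‖f x‖ ^ P ∂μ) ^ (1 / P) ≤ ‖f‖ := by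
      have h2 := hfP.eLpNorm_eq_integral_rpow_norm (by simpa using (by linarith : 0 < P))
        ENNReal.ofReal_ne_top
      rw [ENNReal.toReal_ofReal (by linarith)] at h2
      have h3 := eLpNorm_le_eLpNorm_of_exponent_le hPp (Lp.aestronglyMeasurable f)
      rw [h2] at h3
      rw [Lp.norm_def, one_div]
      exact (ENNReal.ofReal_le_iff_le_toReal (Lp.eLpNorm_ne_top f)).mp h3
    have hg' : (∫ x, ‖g x‖ ^ Q ∂μ) ^ (1 / Q) ≤ d ^ (-1 + 1 / P) := by
      -- Since `Q ≥ 2` and `‖g x‖ ≤ 1`, the `Q`-th power is dominated by the square.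
      have h2 : ∫ x, ‖g x‖ ^ Q ∂μ ≤ 1 / d := by
        refine le_trans ?_ hg2
        refine integral_mono_of_nonneg (Filter.Eventually.of_forall fun x => by positivity)
          ((g.continuous.norm.pow 2).integrable_of_hasCompactSupport
            (HasCompactSupport.of_compactSpace _)) (Filter.Eventually.of_forall fun x => ?_)
        have h3 := Real.rpow_le_rpow_of_exponent_ge_of_imp (norm_nonneg (g x)) (hg x) hQ2
          (fun _ h => by linarith)
        rwa [Real.rpow_two] at h3
      have h4 : 1 / Q = 1 - 1 / P := by
        have := hPQ.inv_add_inv_eq_one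
        rw [one_div, one_div]; linarith
      calc _ ≤ (1 / d) ^ (1 / Q) := by
            refine Real.rpow_le_rpow (integral_nonneg fun x => by positivity) h2 ?_
            exact one_div_nonneg.mpr (by linarith)
        _ = d ^ (-1 + 1 / P) := by
            rw [h4, one_div d, ← Real.rpow_neg_one, ← Real.rpow_mul hd.le]
            congr 1
            ring
    rw [mul_comm]
    gcongr

end LpBounds

/-! ### Gluing rank-one operators into a nuclear operator -/

section Nuclear

variable {E F : Type*} [NormedAddCommGroup E] [NormedSpace ℂ E]
    [NormedAddCommGroup F] [NormedSpace ℂ F]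

/-- All but finitely many terms are at most 1, and there `a i ≤ a i ^ r`. -/
theorem summable_of_summable_rpow {ι : Type*} {a : ι → ℝ} (ha : ∀ i, 0 ≤ a i) {r : ℝ} (hr₀ : 0 < r)
    (hr₁ : r ≤ 1) (h : Summable fun i => a i ^ r) : Summable a := by
  have h1 : ∀ᶠ i in Filter.cofinite, a i ^ r < 1 :=
    h.tendsto_cofinite_zero.eventually (gt_mem_nhds one_pos)
  refine Summable.of_norm_bounded_eventually h ?_
  filter_upwards [h1] with i hi
  rw [Real.norm_of_nonneg (ha i)]
  have hle : a i ≤ 1 := by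
    by_contra hlt
    push Not at hlt
    exact absurd hi (not_lt.mpr (Real.one_le_rpow hlt.le hr₀.le))
  have h2 := Real.rpow_le_rpow_of_exponent_ge_of_imp (ha i) hle hr₁ (fun _ h => absurd h one_ne_zero)
  rwa [Real.rpow_one] at h2

/-- An operator given on a total set by an `r`-summable family of rank-one operators, indexed by
an arbitrary set, is `r`-nuclear. -/
theorem isRNuclear_of_family [CompleteSpace F] {ι : Type*} {r : ℝ} (hr₀ : 0 < r) (hr₁ : r ≤ 1)
    (A : E →L[ℂ] F) (u : ι → E →L[ℂ] ℂ) (y : ι → F)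
    (hsum : Summable fun i => ‖u i‖ ^ r * ‖y i‖ ^ r) (S : Set E)
    (hS : Dense (Submodule.span ℂ S : Set E))
    (hA : ∀ f ∈ S, HasSum (fun i => u i f • y i) (A f)) : IsRNuclear r A := by
  have hnn : ∀ i, 0 ≤ ‖u i‖ * ‖y i‖ := fun i => by positivity
  have hsum' : Summable fun i => (‖u i‖ * ‖y i‖) ^ r := by
    simpa only [Real.mul_rpow (norm_nonneg _) (norm_nonneg _)] using hsum
  have hop : Summable fun i => (u i).smulRight (y i) := by
    refine Summable.of_norm ?_
    simp only [ContinuousLinearMap.norm_smulRight_apply]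
    exact summable_of_summable_rpow hnn hr₀ hr₁ hsum'
  obtain ⟨B, hB⟩ := hop
  have hBx : ∀ x, HasSum (fun i => u i x • y i) (B x) := fun x =>
    hB.mapL (ContinuousLinearMap.apply ℂ F x)
  have hAB : A = B := by
    refine ContinuousLinearMap.ext_on hS fun f hf => ?_
    exact (hA f hf).unique (hBx f)
  subst hAB
  -- The index set may be uncountable, but a summable family has countable support; `T` is injected
  -- into `ℕ` and the sequences are extended by zero.
  set T : Set ι := Function.support fun i => (‖u i‖ * ‖y i‖) ^ r with hT
  have hTc : T.Countable := hsum'.countable_support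
  have : Countable T := hTc.to_subtype
  obtain ⟨e, he⟩ := exists_injective_nat T
  have hoff : ∀ i ∉ T, u i = 0 ∨ y i = 0 := by
    intro i hi
    have h1 : (‖u i‖ * ‖y i‖) ^ r = 0 := by simpa [hT] using hi
    rw [Real.rpow_eq_zero (hnn i) hr₀.ne'] at h1
    simpa using h1
  refine ⟨Function.extend e (fun i => u i) 0, Function.extend e (fun i => y i) 0,
    fun x => ?_, ?_⟩
  · rw [← he.hasSum_iff]
    · have h1 : HasSum ((fun i => u i x • y i) ∘ ((↑) : T → ι)) (A x) := by
        rw [hasSum_subtype_iff_of_support_subset]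
        · exact hBx x
        · intro i hi
          by_contra h
          rcases hoff i h with h | h <;> simp [h] at hi
      refine h1.congr_fun ?_ |> id
      intro i
      simp [he.extend_apply]
    · intro n hn
      rw [Function.extend_apply' _ _ _ (by simpa using hn)]
      simp
  · rw [← he.summable_iff]
    · have h1 := hsum.subtype T
      refine h1.congr fun i => ?_
      simp [he.extend_apply]
    · intro n hn
      rw [Function.extend_apply' _ _ _ (by simpa using hn)]
      simp [Real.zero_rpow hr₀.ne']

end Nuclear

/-! ### The block of the multiplier at one representation -/

section Blocks

variable {G : Type*} [Group G] [TopologicalSpace G]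

/-- The entries of `P * ξ(x) * Q` as continuous functions. -/
def IrrepMatrix.sandwich (ξ : IrrepMatrix G) (P Q : Matrix (Fin ξ.dim) (Fin ξ.dim) ℂ)
    (i k : Fin ξ.dim) : C(G, ℂ) where
  toFun x := (P * ξ.mat x * Q) i k
  continuous_toFun := by
    have := ξ.continuous_mat
    exact ((continuous_const.matrix_mul this).matrix_mul continuous_const).matrix_elem i k

theorem IrrepMatrix.norm_sandwich_le_one (ξ : IrrepMatrix G)
    (P Q : Matrix (Fin ξ.dim) (Fin ξ.dim) ℂ) (hP : P * Pᴴ = 1) (hQ : Q * Qᴴ = 1)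
    (i k : Fin ξ.dim) (x : G) : ‖ξ.sandwich P Q i k x‖ ≤ 1 := by
  have h1 : P * ξ.mat x * Q ∈ Matrix.unitaryGroup (Fin ξ.dim) ℂ :=
    mul_mem (mul_mem (Matrix.mem_unitaryGroup_iff.mpr hP) (ξ.hom x).2)
      (Matrix.mem_unitaryGroup_iff.mpr hQ)
  exact entry_norm_bound_of_unitary h1 i k

/-- For each `k`, `(W k)ᴴ` undoes `W k`, so the rotation may depend on the column; `Vᴴ` then
reassembles the columns. -/
theorem IrrepMatrix.sum_sandwich (ξ : IrrepMatrix G)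
    (W : Fin ξ.dim → Matrix (Fin ξ.dim) (Fin ξ.dim) ℂ) (M V : Matrix (Fin ξ.dim) (Fin ξ.dim) ℂ)
    (hW : ∀ k, (W k)ᴴ * W k = 1) (hV : V * Vᴴ = 1) (a b : Fin ξ.dim) :
    ∑ k, ∑ i, (starRingEnd ℂ (W k i a) * starRingEnd ℂ (V b k)) • ξ.sandwich (W k) (M * V) i k =
      ∑ c, M c b • ξ.coeff a c := by
  ext x
  simp only [ContinuousMap.sum_apply, ContinuousMap.smul_apply, smul_eq_mul]
  have h1 : ∀ k, ∑ i, starRingEnd ℂ (W k i a) * starRingEnd ℂ (V b k) *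
      ξ.sandwich (W k) (M * V) i k x = (ξ.mat x * (M * V)) a k * Vᴴ k b := fun k => by
    have h2 : ξ.mat x * (M * V) = (W k)ᴴ * (W k * ξ.mat x * (M * V)) := by
      rw [Matrix.mul_assoc (W k), ← Matrix.mul_assoc (W k)ᴴ, hW, Matrix.one_mul]
    rw [h2, Matrix.mul_apply, Finset.sum_mul]
    refine Finset.sum_congr rfl fun i _ => ?_
    simp only [Matrix.conjTranspose_apply, RCLike.star_def, IrrepMatrix.sandwich,
      ContinuousMap.coe_mk]
    ring
  simp only [h1]
  rw [← Matrix.mul_apply, Matrix.mul_assoc, Matrix.mul_assoc, hV, Matrix.mul_one, Matrix.mul_apply]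
  exact Finset.sum_congr rfl fun c _ => mul_comm _ _

variable [IsTopologicalGroup G] [CompactSpace G] [MeasurableSpace G] [BorelSpace G]
  (μ : Measure G) [μ.IsHaarMeasure] [IsProbabilityMeasure μ]

theorem pairing_sandwich_coeff (p : ℝ≥0∞) [Fact (1 ≤ p)] (ξ : IrrepMatrix G)
    (P Q : Matrix (Fin ξ.dim) (Fin ξ.dim) ℂ) (i k a b : Fin ξ.dim) :
    pairing μ p (ξ.sandwich P Q i k) (ContinuousMap.toLp p μ ℂ (ξ.coeff a b)) =
      starRingEnd ℂ (P i a) * starRingEnd ℂ (Q b k) / ξ.dim := by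
  rw [pairing_toLp]
  exact integral_coeff_mul_conj_sandwich μ ξ a b P Q i k

theorem pairing_sandwich_coeff_of_not_equivalent (p : ℝ≥0∞) [Fact (1 ≤ p)] (ξ η : IrrepMatrix G)
    (h : ¬ IrrepMatrix.Equivalent ξ η) (P Q : Matrix (Fin ξ.dim) (Fin ξ.dim) ℂ)
    (i k : Fin ξ.dim) (a b : Fin η.dim) :
    pairing μ p (ξ.sandwich P Q i k) (ContinuousMap.toLp p μ ℂ (η.coeff a b)) = 0 := by
  rw [pairing_toLp]
  exact integral_sandwich_mul_conj_of_not_equivalent μ ξ η h a b P Q i k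

theorem norm_pairing_sandwich_le (p : ℝ≥0∞) [Fact (1 ≤ p)] (hp : p ≠ ⊤) (ξ : IrrepMatrix G)
    (P Q : Matrix (Fin ξ.dim) (Fin ξ.dim) ℂ) (hP : P * Pᴴ = 1) (hQ : Q * Qᴴ = 1)
    (i k : Fin ξ.dim) :
    ‖pairing μ p (ξ.sandwich P Q i k)‖ ≤ (ξ.dim : ℝ) ^ (-1 + 1 / min 2 p.toReal) := by
  refine norm_pairing_le μ p hp _ (ξ.norm_sandwich_le_one P Q hP hQ i k)
    (by exact_mod_cast ξ.dim_pos) (le_of_eq ?_)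
  exact integral_norm_sq_sandwich μ ξ P Q hP (mul_eq_one_comm.mp hQ) i k

/-- The constant relating the nuclear decomposition to the Schatten norm of the symbol. -/
def nuclearConst (m : ℕ) (r : ℝ) : ℝ :=
  (2 ^ m * khintchineConst m) ^ (r / (2 * m : ℕ))

theorem IrrepMatrix.exists_unitary_sandwich_moment_le (ξ : IrrepMatrix G) (m : ℕ) (hm : m ≠ 0)
    (M V : Matrix (Fin ξ.dim) (Fin ξ.dim) ℂ) (k : Fin ξ.dim) (s : ℝ)
    (hs : ∀ x, ∑ j, ‖(ξ.mat x * M * V) j k‖ ^ 2 ≤ s ^ 2) :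
    ∃ W : Matrix (Fin ξ.dim) (Fin ξ.dim) ℂ, W * Wᴴ = 1 ∧
      ∑ i, ∫ x, ‖ξ.sandwich W (M * V) i k x‖ ^ (2 * m) ∂μ ≤
        ξ.dim * (2 ^ m * khintchineConst m * (s ^ 2 / ξ.dim) ^ m) := by
  have hrow : ∀ (W : Matrix (Fin ξ.dim) (Fin ξ.dim) ℂ) (x : G) (i : Fin ξ.dim),
      (W *ᵥ fun j => (ξ.mat x * M * V) j k) i = ξ.sandwich W (M * V) i k x := by
    intro W x i
    change (W * (ξ.mat x * M * V)) i k = (W * ξ.mat x * (M * V)) i k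
    simp only [Matrix.mul_assoc]
  have hcont : ∀ j, Continuous fun x => (ξ.mat x * M * V) j k := fun j =>
    ((ξ.continuous_mat.matrix_mul continuous_const).matrix_mul continuous_const).matrix_elem j k
  obtain ⟨W, hW, hWs⟩ := exists_unitary_sum_integral_pow_le μ ξ.dim_pos m hm
    (fun x j => (ξ.mat x * M * V) j k) s hs fun c => by
      refine integrable_of_continuous μ (Continuous.pow (Continuous.norm ?_) _)
      exact continuous_finsetSum _ fun j _ => continuous_const.mul (hcont j)
  simp only [hrow] at hWs
  exact ⟨W, hW, hWs⟩

/-- The component of a Fourier multiplier at one irreducible representation is a sum of rank-one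
operators with controlled norms. -/
theorem exists_rank_one_decomposition (p₁ p₂ : ℝ≥0∞) [Fact (1 ≤ p₁)] [Fact (1 ≤ p₂)] (hp₁ : p₁ ≠ ⊤)
    (m : ℕ) (hm : m ≠ 0) (hp₂ : p₂ ≤ (2 * m : ℕ)) {r : ℝ} (hr₀ : 0 < r) (hr₁ : r ≤ 1)
    (ξ : IrrepMatrix G) (M : Matrix (Fin ξ.dim) (Fin ξ.dim) ℂ) :
    ∃ (u : Fin ξ.dim × Fin ξ.dim → Lp ℂ p₁ μ →L[ℂ] ℂ) (y : Fin ξ.dim × Fin ξ.dim → Lp ℂ p₂ μ),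
      (∀ a b, ∑ t, u t (ContinuousMap.toLp p₁ μ ℂ (ξ.coeff a b)) • y t =
        ContinuousMap.toLp p₂ μ ℂ (∑ c, M c b • ξ.coeff a c)) ∧
      (∀ η : IrrepMatrix G, ¬ IrrepMatrix.Equivalent ξ η → ∀ a b t,
        u t (ContinuousMap.toLp p₁ μ ℂ (η.coeff a b)) = 0) ∧
      ∑ t, ‖u t‖ ^ r * ‖y t‖ ^ r ≤ nuclearConst m r *
        ((ξ.dim : ℝ) ^ (1 + (1 / min 2 p₁.toReal - 1 / 2) * r) * schattenNorm r M ^ r) := by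
  obtain ⟨V, s, hV, hs, hsU, hsr⟩ := exists_singular_basis M
  have hd0 : 0 < ξ.dim := ξ.dim_pos
  have hdR : (0 : ℝ) < ξ.dim := by exact_mod_cast hd0
  -- The unitary `ξ(x)` preserves column norms, so column `k` of `ξ(x) M V` has norm exactly `s k`
  -- at every `x`.
  have hWex := fun k => ξ.exists_unitary_sandwich_moment_le μ m hm M V k (s k) fun x =>
    (hsU _ (ξ.conjTranspose_mul_mat x) k).le
  choose W hW hWs using hWex
  refine ⟨fun t => pairing μ p₁ (ξ.sandwich (W t.1) V t.2 t.1),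
    -- The factor `ξ.dim` cancels the `1 / ξ.dim` of Schur orthogonality.
    fun t => ContinuousMap.toLp p₂ μ ℂ ((ξ.dim : ℂ) • ξ.sandwich (W t.1) (M * V) t.2 t.1),
    fun a b => ?_, fun η h a b t => ?_, ?_⟩
  · rw [← ξ.sum_sandwich W M V (fun k => mul_eq_one_comm.mp (hW k)) hV, Fintype.sum_prod_type,
      map_sum]
    refine Finset.sum_congr rfl fun k _ => ?_
    rw [map_sum]
    refine Finset.sum_congr rfl fun i _ => ?_
    rw [pairing_sandwich_coeff, ← map_smul, smul_smul, div_mul_cancel₀]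
    exact_mod_cast hd0.ne'
  · exact pairing_sandwich_coeff_of_not_equivalent μ p₁ ξ η h _ _ _ _ a b
  · rw [hsr r hr₀, Fintype.sum_prod_type]
    set P := min 2 p₁.toReal with hP
    set q : ℝ := r / (2 * m : ℕ) with hq
    have hm' : (1 : ℝ) ≤ (2 * m : ℕ) := by
      have : 1 ≤ 2 * m := by omega
      exact_mod_cast this
    have hq0 : 0 < q := by positivity
    have hq1 : q ≤ 1 := by
      rw [hq, div_le_one (by linarith)]; linarith
    let I : Fin ξ.dim → Fin ξ.dim → ℝ := fun k i => ∫ x, ‖ξ.sandwich (W k) (M * V) i k x‖ ^ (2 * m) ∂μ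
    have hI0 : ∀ k i, 0 ≤ I k i := fun k i => integral_nonneg fun x => by positivity
    have hterm : ∀ k i, ‖pairing μ p₁ (ξ.sandwich (W k) V i k)‖ ^ r *
        ‖ContinuousMap.toLp p₂ μ ℂ ((ξ.dim : ℂ) • ξ.sandwich (W k) (M * V) i k)‖ ^ r ≤
        (ξ.dim : ℝ) ^ (1 / P * r) * I k i ^ q := by
      intro k i
      have h1 := norm_pairing_sandwich_le μ p₁ hp₁ ξ (W k) V (hW k) hV i k
      have h2 := norm_toLp_le_integral_pow_rpow μ p₂ m hm hp₂ (ξ.sandwich (W k) (M * V) i k)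
      have h3 : ‖ContinuousMap.toLp p₂ μ ℂ ((ξ.dim : ℂ) • ξ.sandwich (W k) (M * V) i k)‖ ≤
          ξ.dim * I k i ^ ((1 : ℝ) / (2 * m : ℕ)) := by
        rw [map_smul, norm_smul, Complex.norm_natCast]
        gcongr
      calc _ ≤ ((ξ.dim : ℝ) ^ (-1 + 1 / P)) ^ r * (ξ.dim * I k i ^ ((1 : ℝ) / (2 * m : ℕ))) ^ r := by
            gcongr
        _ = ((ξ.dim : ℝ) ^ (-1 + 1 / P) * ξ.dim) ^ r * I k i ^ q := by
            rw [Real.mul_rpow hdR.le (Real.rpow_nonneg (hI0 k i) _), ← Real.rpow_mul (hI0 k i),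
              Real.mul_rpow (by positivity) hdR.le, hq, one_div_mul_eq_div, mul_assoc]
        _ = _ := by
            congr 1
            rw [← Real.rpow_add_one hdR.ne', ← Real.rpow_mul hdR.le]
            congr 1
            ring
    -- Only the sum of the moments over `i` is controlled; concavity (`q ≤ 1`) turns this into a
    -- bound on the sum of `q`-th powers.
    have hk : ∀ k, ∑ i, I k i ^ q ≤
        ξ.dim * (nuclearConst m r * (s k ^ r * (ξ.dim : ℝ) ^ (-(1 / 2) * r))) := by
      intro k
      have h0 := khintchineConst_nonneg m
      have hs2 : 0 ≤ s k ^ 2 / ξ.dim := by positivity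
      refine (sum_rpow_le_of_sum_le (I k) (hI0 k) (by positivity) (hWs k) hq0 hq1).trans
        (le_of_eq ?_)
      rw [Real.mul_rpow (by positivity) (by positivity), nuclearConst]
      congr 2
      rw [← Real.rpow_natCast, ← Real.rpow_mul hs2, hq]
      have h4 : (m : ℝ) * (r / (2 * m : ℕ)) = r / 2 := by
        have : (m : ℝ) ≠ 0 := by exact_mod_cast hm
        push_cast
        field_simp
      rw [h4, Real.div_rpow (by positivity) hdR.le, ← Real.rpow_natCast (s k),
        ← Real.rpow_mul (hs k), div_eq_mul_inv, ← Real.rpow_neg hdR.le]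
      congr 2 <;> push_cast <;> ring
    calc _ ≤ ∑ k, ∑ i, (ξ.dim : ℝ) ^ (1 / P * r) * I k i ^ q :=
          Finset.sum_le_sum fun k _ => Finset.sum_le_sum fun i _ => hterm k i
      _ ≤ ∑ k, (ξ.dim : ℝ) ^ (1 / P * r) *
          (ξ.dim * (nuclearConst m r * (s k ^ r * (ξ.dim : ℝ) ^ (-(1 / 2) * r)))) := by
          refine Finset.sum_le_sum fun k _ => ?_
          rw [← Finset.mul_sum]
          exact mul_le_mul_of_nonneg_left (hk k) (by positivity)
      _ = _ := by
          rw [Finset.mul_sum, Finset.mul_sum]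
          refine Finset.sum_congr rfl fun k _ => ?_
          have h5 : (ξ.dim : ℝ) ^ (1 + (1 / P - 1 / 2) * r) =
              (ξ.dim : ℝ) ^ (1 / P * r) * ξ.dim * (ξ.dim : ℝ) ^ (-(1 / 2) * r) := by
            rw [← Real.rpow_add_one hdR.ne', ← Real.rpow_add hdR]
            congr 1
            ring
          rw [h5]
          ring

end Blocks

/-! ### From blocks to the whole multiplier -/

section Multipliers

variable {G : Type*} [Group G] [TopologicalSpace G]

/-- The second summability condition dominates the first. -/
theorem schattenNorm_rpow_le {d : ℕ} (hd : 0 < d) (M : Matrix (Fin d) (Fin d) ℂ) {p r : ℝ}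
    (hp : 2 < p) (hr : 0 < r) (c : ℝ) :
    (d : ℝ) ^ (1 + (c - 1 / 2) * r) * schattenNorm r M ^ r ≤
      (d : ℝ) ^ (1 + (c - 1 / p) * r) * opNormLinfty Mᵀ ^ ((p - 2) / p * r) *
        schattenNorm (2 * r / p) M ^ (2 * r / p) := by
  obtain ⟨V, s, hV, hs, hsU, hsr⟩ := exists_singular_basis M
  have hdR : (0 : ℝ) < d := by exact_mod_cast hd
  have hp0 : 0 < p := by linarith
  have he : 0 < (p - 2) / p * r := by
    have : 0 < p - 2 := by linarith
    positivity
  have hN : 0 ≤ opNormLinfty Mᵀ :=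
    Real.iSup_nonneg fun i => Finset.sum_nonneg fun _ _ => norm_nonneg _
  rw [hsr r hr, hsr (2 * r / p) (by positivity), Finset.mul_sum, Finset.mul_sum]
  refine Finset.sum_le_sum fun k _ => ?_
  have h1 : s k ≤ √d * opNormLinfty Mᵀ :=
    le_sqrt_card_mul_opNormLinfty M V hV k (s k) (hs k) (by simpa using hsU 1 (by simp) k)
  -- The first factor is estimated by the column sum, at the cost of `d ^ ((1 / 2 - 1 / p) * r)`,
  -- which is the difference of the two dimension exponents.
  have h2 : s k ^ r = s k ^ ((p - 2) / p * r) * s k ^ (2 * r / p) := by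
    rw [← Real.rpow_add_of_nonneg (hs k) he.le (by positivity)]
    congr 1
    field_simp
    ring
  have h3 : s k ^ ((p - 2) / p * r) ≤
      (d : ℝ) ^ ((p - 2) / p * r / 2) * opNormLinfty Mᵀ ^ ((p - 2) / p * r) := by
    refine (Real.rpow_le_rpow (hs k) h1 he.le).trans (le_of_eq ?_)
    rw [Real.mul_rpow (Real.sqrt_nonneg _) hN, Real.sqrt_eq_rpow, ← Real.rpow_mul hdR.le]
    congr 2
    ring
  have h4 : (d : ℝ) ^ (1 + (c - 1 / p) * r) =
      (d : ℝ) ^ (1 + (c - 1 / 2) * r) * (d : ℝ) ^ ((p - 2) / p * r / 2) := by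
    rw [← Real.rpow_add hdR]
    congr 1
    field_simp
    ring
  rw [h2, h4]
  calc _ ≤ (d : ℝ) ^ (1 + (c - 1 / 2) * r) * (((d : ℝ) ^ ((p - 2) / p * r / 2) *
        opNormLinfty Mᵀ ^ ((p - 2) / p * r)) * s k ^ (2 * r / p)) := by
        have := hs k
        gcongr
    _ = _ := by ring

theorem schattenNorm_rpow_nonneg {d : ℕ} (M : Matrix (Fin d) (Fin d) ℂ) {r : ℝ} (hr : 0 < r) :
    0 ≤ schattenNorm r M ^ r := by
  obtain ⟨V, s, hV, hs, hsU, hsr⟩ := exists_singular_basis M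
  rw [hsr r hr]
  exact Finset.sum_nonneg fun k _ => Real.rpow_nonneg (hs k) _

theorem IrrepMatrix.coeff_mem_span_of_equivalent (ξ η : IrrepMatrix G)
    (h : IrrepMatrix.Equivalent ξ η) (i j : Fin η.dim) :
    η.coeff i j ∈ Submodule.span ℂ {f | ∃ a b, f = ξ.coeff a b} := by
  obtain ⟨U, hU₁, hU₂, hU⟩ := h
  have h1 : η.coeff i j = ∑ b, ∑ a, (U i a * Uᴴ b j) • ξ.coeff a b := by
    ext x
    have h2 : η.mat x = U * ξ.mat x * Uᴴ := by rw [hU, Matrix.mul_assoc, hU₂, Matrix.mul_one]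
    change η.mat x i j = _
    rw [h2, Matrix.mul_apply, ContinuousMap.sum_apply]
    refine Finset.sum_congr rfl fun b _ => ?_
    rw [Matrix.mul_apply, Finset.sum_mul, ContinuousMap.sum_apply]
    refine Finset.sum_congr rfl fun a _ => ?_
    rw [ContinuousMap.smul_apply, smul_eq_mul]
    change U i a * ξ.mat x a b * _ = _ * ξ.mat x a b
    ring
  rw [h1]
  exact Submodule.sum_mem _ fun b _ => Submodule.sum_mem _ fun a _ =>
    Submodule.smul_mem _ _ (Submodule.subset_span ⟨a, b, rfl⟩)

variable [IsTopologicalGroup G] [T2Space G] [CompactSpace G] [SecondCountableTopology G]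
  [MeasurableSpace G] [BorelSpace G] (μ : Measure G) [μ.IsHaarMeasure] [IsProbabilityMeasure μ]

/-- Matrix coefficients of a system of representatives of the unitary dual are total in `L^p`. -/
theorem dense_span_coeff (p : ℝ≥0∞) [Fact (1 ≤ p)] (hp : p ≠ ⊤)
    (ξ : UnitaryDual G → IrrepMatrix G)
    (hξ : ∀ π : UnitaryDual G, (Quotient.mk _ (ξ π) : UnitaryDual G) = π) :
    Dense (Submodule.span ℂ {f : Lp ℂ p μ | ∃ (π : UnitaryDual G) (a b : Fin (ξ π).dim),
      f = ContinuousMap.toLp p μ ℂ ((ξ π).coeff a b)} : Set (Lp ℂ p μ)) := by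
  set S := Submodule.span ℂ {f : Lp ℂ p μ | ∃ (π : UnitaryDual G) (a b : Fin (ξ π).dim),
      f = ContinuousMap.toLp p μ ℂ ((ξ π).coeff a b)}
  have hle : coeffSpan G ≤ S.comap ((ContinuousMap.toLp p μ ℂ : C(G, ℂ) →L[ℂ] Lp ℂ p μ) : C(G, ℂ) →ₗ[ℂ] Lp ℂ p μ) := by
    refine Submodule.span_le.mpr ?_
    rintro _ ⟨η, i, j, rfl⟩
    have heq : IrrepMatrix.Equivalent (ξ (Quotient.mk _ η)) η := Quotient.exact (hξ _)
    refine Submodule.span_le.mpr ?_ (IrrepMatrix.coeff_mem_span_of_equivalent _ η heq i j)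
    rintro _ ⟨a, b, rfl⟩
    exact Submodule.subset_span ⟨_, a, b, rfl⟩
  have hd : Dense (coeffSpan G : Set C(G, ℂ)) := by
    rw [Submodule.dense_iff_topologicalClosure_eq_top]
    exact topologicalClosure_coeffSpan μ
  have hr := ContinuousMap.toLp_denseRange ℂ μ ℂ hp
  refine (hr.dense_image (ContinuousMap.toLp p μ ℂ).continuous hd).mono ?_
  rintro _ ⟨f, hf, rfl⟩
  exact hle hf

theorem apply_coeff_of_symbol {p₁ p₂ : ℝ≥0∞} [Fact (1 ≤ p₁)] [Fact (1 ≤ p₂)]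
    (A : Lp ℂ p₁ μ →L[ℂ] Lp ℂ p₂ μ) (ξ : IrrepMatrix G) (M : Matrix (Fin ξ.dim) (Fin ξ.dim) ℂ)
    (hM : ∀ᵐ x ∂μ, symbol A x ξ = M) (a b : Fin ξ.dim) :
    A (ContinuousMap.toLp p₁ μ ℂ (ξ.coeff a b)) =
      ContinuousMap.toLp p₂ μ ℂ (∑ c, M c b • ξ.coeff a c) := by
  apply Lp.ext
  filter_upwards [hM, ContinuousMap.coeFn_toLp (p := p₂) (𝕜 := ℂ) μ
    (∑ c, M c b • ξ.coeff a c)] with x hx hx'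
  rw [hx', ContinuousMap.sum_apply]
  have h1 := congrArg (fun N => (ξ.mat x * N) a b) hx
  simp only [symbol] at h1
  rw [← Matrix.mul_assoc, ξ.mat_mul_conjTranspose, Matrix.one_mul, Matrix.of_apply,
    Matrix.mul_apply] at h1
  rw [h1]
  exact Finset.sum_congr rfl fun c _ => mul_comm _ _

/-- A Fourier multiplier whose symbol satisfies the Schatten condition is `r`-nuclear, for every
finite exponent of the target space. -/
theorem isRNuclear_of_summable_schattenNorm (p₁ p₂ : ℝ≥0∞) [Fact (1 ≤ p₁)] [Fact (1 ≤ p₂)]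
    (hp₁ : p₁ ≠ ⊤) (hp₂ : p₂ ≠ ⊤) {r : ℝ} (hr₀ : 0 < r) (hr₁ : r ≤ 1)
    (ξ : UnitaryDual G → IrrepMatrix G)
    (hξ : ∀ π : UnitaryDual G, (Quotient.mk _ (ξ π) : UnitaryDual G) = π)
    (A : Lp ℂ p₁ μ →L[ℂ] Lp ℂ p₂ μ)
    (σ : (π : UnitaryDual G) → Matrix (Fin (ξ π).dim) (Fin (ξ π).dim) ℂ)
    (hσ : ∀ π, ∀ᵐ x ∂μ, symbol A x (ξ π) = σ π)
    (hsum : Summable fun π : UnitaryDual G =>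
      ((ξ π).dim : ℝ) ^ (1 + (1 / min 2 p₁.toReal - 1 / 2) * r) * schattenNorm r (σ π) ^ r) :
    IsRNuclear r A := by
  -- On a probability space the `L^{p₂}` norm is at most the `L^{2m}` norm, so any even exponent
  -- above `p₂` will do; one `m` serves all representations, keeping the constant uniform.
  obtain ⟨m, hm, hp₂m⟩ : ∃ m : ℕ, m ≠ 0 ∧ p₂ ≤ (2 * m : ℕ) := by
    obtain ⟨k, hk⟩ := ENNReal.exists_nat_gt hp₂
    refine ⟨k + 1, by omega, hk.le.trans ?_⟩
    exact_mod_cast (by omega : k ≤ 2 * (k + 1))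
  choose u y huy hu0 hle using fun π =>
    exists_rank_one_decomposition μ p₁ p₂ hp₁ m hm hp₂m hr₀ hr₁ (ξ π) (σ π)
  refine isRNuclear_of_family hr₀ hr₁ A
    (fun t : Σ π : UnitaryDual G, Fin (ξ π).dim × Fin (ξ π).dim => u t.1 t.2)
    (fun t => y t.1 t.2) ?_ _ (dense_span_coeff μ p₁ hp₁ ξ hξ) ?_
  · rw [summable_sigma_of_nonneg fun t => by positivity]
    refine ⟨fun π => Summable.of_finite, ?_⟩
    simp only [tsum_fintype]
    exact Summable.of_nonneg_of_le (fun π => Finset.sum_nonneg fun t _ => by positivity) hle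
      (hsum.mul_left _)
  · rintro _ ⟨π₀, a, b, rfl⟩
    rw [apply_coeff_of_symbol μ A (ξ π₀) (σ π₀) (hσ π₀) a b, ← huy π₀ a b]
    have h := hasSum_fintype fun t => u π₀ t (ContinuousMap.toLp p₁ μ ℂ ((ξ π₀).coeff a b)) • y π₀ t
    refine (Function.Injective.hasSum_iff (g := Sigma.mk π₀) sigma_mk_injective ?_).mp h
    rintro ⟨π, t⟩ hnot
    -- Blocks of other classes annihilate this coefficient, leaving a finite sum.
    have hne : ¬ IrrepMatrix.Equivalent (ξ π) (ξ π₀) := fun heq => by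
      have : π = π₀ := by
        rw [← hξ π, ← hξ π₀]
        exact Quotient.sound heq
      subst this
      exact hnot ⟨t, rfl⟩
    change u π t _ • y π t = 0
    rw [hu0 π _ hne, zero_smul]

end Multipliers

end CompactLie

end

theorem mainTheorem5 {n : ℕ} {G : Type*} [Group G] [TopologicalSpace G]
    [ChartedSpace (EuclideanSpace ℝ (Fin n)) G] [LieGroup (𝓡 n) (⊤ : ℕ∞) G] [T2Space G] [CompactSpace G]
    [MeasurableSpace G] [BorelSpace G] (μ : Measure G) [μ.IsHaarMeasure] [IsProbabilityMeasure μ]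
    (p₁ p₂ : ℝ≥0∞) [Fact (1 ≤ p₁)] [Fact (1 ≤ p₂)] (hp₁ : p₁ ≠ ⊤) (hp₂ : p₂ ≠ ⊤)
    (r : ℝ) (hr₀ : 0 < r) (hr₁ : r ≤ 1)
    -- a choice of a matrix representation in each class of the unitary dual
    (ξ : CompactLie.UnitaryDual G → CompactLie.IrrepMatrix G)
    (hξ : ∀ π : CompactLie.UnitaryDual G, (Quotient.mk _ (ξ π) : CompactLie.UnitaryDual G) = π)
    (A : Lp ℂ p₁ μ →L[ℂ] Lp ℂ p₂ μ)
    -- the symbol of `A` is `σ π` at `ξ π`, independently of `x`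
    (σ : (π : CompactLie.UnitaryDual G) → Matrix (Fin (ξ π).dim) (Fin (ξ π).dim) ℂ)
    (hσ : ∀ π, ∀ᵐ x ∂μ, CompactLie.symbol A x (ξ π) = σ π) :
    (p₂ ≤ 2 →
      (Summable fun π : CompactLie.UnitaryDual G =>
        ((ξ π).dim : ℝ) ^ (1 + (1 / min 2 p₁.toReal - 1 / 2) * r) *
          CompactLie.schattenNorm r (σ π) ^ r) →
      CompactLie.IsRNuclear r A) ∧
    (2 < p₂ →
      (Summable fun π : CompactLie.UnitaryDual G =>
        ((ξ π).dim : ℝ) ^ (1 + (1 / min 2 p₁.toReal - 1 / p₂.toReal) * r) *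
          CompactLie.opNormLinfty (σ π)ᵀ ^ ((p₂.toReal - 2) / p₂.toReal * r) *
          CompactLie.schattenNorm (2 * r / p₂.toReal) (σ π) ^ (2 * r / p₂.toReal)) →
      CompactLie.IsRNuclear r A) := by
  -- The Lie structure supplies the topological group and second countability on which the
  -- Peter–Weyl argument relies.
  have := topologicalGroup_of_lieGroup (𝓡 n) (⊤ : ℕ∞) (G := G)
  have : SecondCountableTopology G :=
    ChartedSpace.secondCountable_of_sigmaCompact (EuclideanSpace ℝ (Fin n)) G
  refine ⟨fun _ h => CompactLie.isRNuclear_of_summable_schattenNorm μ p₁ p₂ hp₁ hp₂ hr₀ hr₁ ξ hξ A σ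
    hσ h, fun h2 h => ?_⟩
  have hp2 : 2 < p₂.toReal := by
    have h3 := (ENNReal.toReal_lt_toReal ENNReal.ofNat_ne_top hp₂).mpr h2
    simpa using h3
  refine CompactLie.isRNuclear_of_summable_schattenNorm μ p₁ p₂ hp₁ hp₂ hr₀ hr₁ ξ hξ A σ hσ
    (Summable.of_nonneg_of_le (fun π => ?_) (fun π => ?_) h)
  · exact mul_nonneg (by positivity) (CompactLie.schattenNorm_rpow_nonneg _ hr₀)
  · exact CompactLie.schattenNorm_rpow_le (ξ π).dim_pos (σ π) hp2 hr₀ _
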